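/- **Notation.** For a probability measure $\mu$ on $\mathbb R$ put $G_\mu(z)=\int\frac{d\mu(t)}{z-t}$, $F_\mu=1/G_\mu$, $h_\mu(w)=w-F_\mu(w)$ and $\tilde h_\mu(w)=w^{-2}\,(w-F_\mu(w))$, for $w$ outside the support of $\mu$; let $\mathbb C^+=\{\operatorname{Im} z>0\}$ and $\mathbb C_K=\{z:\operatorname{Im} z>K\}$. Let $\eta_\mu(w)=w\,(w^{-1}-F_\mu(w^{-1}))$ for $w\in\mathbb C\setminus\mathbb R$, and $\Sigma_\mu(u)=\eta_\mu^{\langle -1\rangle}(u)/u$, where $\eta_\mu^{\langle -1\rangle}$ is the inverse of $\eta_\mu$ near $0$ on truncated cones $\{|\operatorname{Re} u|<\alpha|\operatorname{Im} u|,\ |u|<r\}$: it takes values in such a cone and tends to $0$ at $0$. For measures $\mu_1,\mu_2,\mu_3$ with finite second moment and nonzero mean, $\mu_1$ supported on $[0,\infty)$, the relation $\mu_1\boxtimes\mu_2=\mu_3$ means $\Sigma_{\mu_1}\Sigma_{\mu_2}=\Sigma_{\mu_3}$ on some such cone. The Jacobi parameters $\beta_n,\gamma_n$ of $\mu$ are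 the coefficients in the recurrence $tP_n=P_{n+1}+\beta_nP_n+\gamma_{n-1}P_{n-1}$ of its monic orthogonal polynomials: $\beta_n=\int tP_n^2\,d\mu/\int P_n^2\,d\mu$ and $\gamma_n=\int P_{n+1}^2\,d\mu/\int P_n^2\,d\mu$ (put equal to $0$ if $\int P_n^2\,d\mu=0$). **Theorem.** Let $\mu_1,\mu_3$ be probability measures on $\mathbb R$, both with mean $1$, such that $\mu_1$ is supported on $[0,\infty)$ and has a finite fourth moment and $\mu_3$ has a finite second moment. Let $\sigma_1^2,\sigma_3^2$ be their variances, $\beta_1,\gamma_1$ the Jacobi parameters of index $1$ of $\mu_1$, and $$K=\Big[6\big(2\sigma_1^2+\sqrt{5\sigma_1^4+2\sigma_3^2\sigma_1^2}\big)\Big]\vee\Big[R+\tfrac32\sqrt{R^2+4R\sigma_3^2}\Big],\qquad R=(2\sqrt{\gamma_1})\vee\beta_1 .$$ Then $K\ge 0$, $K>0$ if $\sigma_1\neq0$, and $K$ is at most the value of the same expression with $R=2(\sqrt{\gamma_1}\vee\beta_1)$. For $z\in\mathbb C_K$ let $$T_z(w)=z\,h_{\mu_1}\!\big(\tilde h_{\mu_3}(w)^{-1}z^{-1}\big),\qquad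 w\in D\big(z,\tfrac{\operatorname{Im}z}{5}\big).$$ This is a well-defined map of the disc $D(z,\frac{\operatorname{Im} z}5)\subset\mathbb C^+$ into itself, that is, $\tilde h_{\mu_3}(w)\ne0$ and $\tilde h_{\mu_3}(w)^{-1}z^{-1}\in\mathbb C\setminus[0,\infty)$ there. There are unique functions $\omega_1:\mathbb C_K\to\mathbb C\setminus[0,\infty)$ and $\omega_3:\mathbb C_K\to\mathbb C^+$ such that 1. for all $z\in\mathbb C_K$, $\omega_3(z)$ is the unique fixed point of $T_z$ in $D(z,\frac{\operatorname{Im}z}5)$, and $T_z^{\circ n}(w)\to\omega_3(z)$ as $n\to\infty$ for every $w\in D(z,\frac{\operatorname{Im}z}5)$; 2. $\omega_1(z)=\dfrac1{z\,\tilde h_{\mu_3}(\omega_3(z))}$ for all $z\in\mathbb C_K$; 3. for every probability measure $\mu_2$ on $\mathbb R$ with finite second moment and nonzero mean such that $\mu_1\boxtimes\mu_2=\mu_3$, one has $F_{\mu_2}(z)=F_{\mu_3}(\omega_3(z))\,z\,\omega_3(z)^{-1}$ for all $z\in\mathbb C_K$. -/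

import Mathlib

open MeasureTheory ProbabilityTheory Filter Topology

noncomputable section

namespace FreeDeconv

/-! ### Transforms of a probability measure on the line -/

/-- The Cauchy transform `G_μ(z) = ∫ 1/(z-t) dμ(t)`, for `z` outside the support of `μ`. -/
def cauchyG (μ : Measure ℝ) (z : ℂ) : ℂ := ∫ t, (z - (t : ℂ))⁻¹ ∂μ

/-- The reciprocal Cauchy transform `F_μ = 1 / G_μ`. -/
def recipF (μ : Measure ℝ) (z : ℂ) : ℂ := (cauchyG μ z)⁻¹

/-- The `h`-transform `h_μ(w) = w - F_μ(w)`. -/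
def hTransform (μ : Measure ℝ) (w : ℂ) : ℂ := w - recipF μ w

/-- The transform `w⁻² (w - F_μ(w))`. -/
def hTilde (μ : Measure ℝ) (w : ℂ) : ℂ := (w ^ 2)⁻¹ * (w - recipF μ w)

/-- The `η`-transform `η_μ(w) = w (w⁻¹ - F_μ(w⁻¹))`, for non-real `w`. -/
def eta (μ : Measure ℝ) (w : ℂ) : ℂ := w * (w⁻¹ - recipF μ w⁻¹)

/-! ### Jacobi parameters -/

/-- The squared norm of a polynomial in `L²(μ)`. -/
def polyNormSq (μ : Measure ℝ) (P : Polynomial ℝ) : ℝ := ∫ t, (P.eval t) ^ 2 ∂μ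

/-- `⟨X P, P⟩ / ⟨P, P⟩` in `L²(μ)`. -/
def polyBeta (μ : Measure ℝ) (P : Polynomial ℝ) : ℝ :=
  (∫ t, t * (P.eval t) ^ 2 ∂μ) / polyNormSq μ P

open Polynomial in
/-- The monic orthogonal polynomials of `μ`, through their three-term recurrence. -/
def orthoPoly (μ : Measure ℝ) : ℕ → Polynomial ℝ
  | 0 => 1
  | 1 => X - C (polyBeta μ 1)
  | n + 2 =>
      (X - C (polyBeta μ (orthoPoly μ (n + 1)))) * orthoPoly μ (n + 1)
        - C (polyNormSq μ (orthoPoly μ (n + 1)) / polyNormSq μ (orthoPoly μ n)) * orthoPoly μ n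

/-- The Jacobi parameter `β_n(μ)`, the coefficient in
`X P_n = P_{n+1} + β_n P_n + γ_{n-1} P_{n-1}`.  For the finitely supported measures whose
Jacobi sequence ends before `n` it is `0`. -/
def jacobiBeta (μ : Measure ℝ) (n : ℕ) : ℝ := polyBeta μ (orthoPoly μ n)

/-- The Jacobi parameter `γ_n(μ) = ‖P_{n+1}‖² / ‖P_n‖²` (`γ_0` is the variance).  For the finitely
supported measures whose Jacobi sequence ends before `n` it is `0`. -/
def jacobiGamma (μ : Measure ℝ) (n : ℕ) : ℝ :=
  polyNormSq μ (orthoPoly μ (n + 1)) / polyNormSq μ (orthoPoly μ n)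

/-! ### Free multiplicative convolution -/

/-- The truncated double cone `|Re u| < α |Im u|`, `|u| < r` with apex `0`: a non-tangential
neighbourhood of `0` in `ℂ ∖ ℝ`. -/
def stolz (α r : ℝ) : Set ℂ := {u | |u.re| < α * |u.im| ∧ ‖u‖ < r}

/-- `χ` is, on `Ω`, the inverse `η_μ^{<-1>}` of `η_μ` near `0`: it solves `η_μ(χ(u)) = u`,
takes its values in some cone `stolz β s`, and tends to `0` as `u → 0` in `Ω`. -/
def IsEtaInverse (μ : Measure ℝ) (Ω : Set ℂ) (χ : ℂ → ℂ) : Prop :=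
  (∃ β > 0, ∃ s > 0, Set.MapsTo χ Ω (stolz β s)) ∧
    (∀ u ∈ Ω, eta μ (χ u) = u) ∧ Tendsto χ (𝓝[Ω] 0) (𝓝 0)

/-- `S` is, on `Ω`, the transform `Σ_μ(u) = η_μ^{<-1>}(u) / u`. -/
def IsSigmaTransform (μ : Measure ℝ) (Ω : Set ℂ) (S : ℂ → ℂ) : Prop :=
  ∃ χ : ℂ → ℂ, IsEtaInverse μ Ω χ ∧ ∀ u ∈ Ω, S u = χ u / u

/-- The relation `μ₁ ⊠ μ₂ = μ₃` (for measures with finite second moment and nonzero mean, `μ₁`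
supported on `[0,∞)`): `Σ_{μ₁} Σ_{μ₂} = Σ_{μ₃}` on a common non-tangential neighbourhood of `0`. -/
def IsFreeMulConv (μ₁ μ₂ μ₃ : Measure ℝ) : Prop :=
  ∃ α > 0, ∃ r > 0, ∃ S₁ S₂ S₃ : ℂ → ℂ,
    IsSigmaTransform μ₁ (stolz α r) S₁ ∧
    IsSigmaTransform μ₂ (stolz α r) S₂ ∧
    IsSigmaTransform μ₃ (stolz α r) S₃ ∧
    ∀ u ∈ stolz α r, S₁ u * S₂ u = S₃ u

/-! ### The objects of the deconvolution -/

/-- The half-plane `ℂ_K = {Im z > K}`. -/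
def upperPlane (K : ℝ) : Set ℂ := {z | K < z.im}

/-- `ℂ ∖ [0,∞)`, the domain of the transforms of a measure supported on `[0,∞)`. -/
def slitPlanePos : Set ℂ := {w | ¬ (w.im = 0 ∧ 0 ≤ w.re)}

/-- The map `T_z(w) = z h_{μ₁}(h̃_{μ₃}(w)⁻¹ z⁻¹)`. -/
def iterT (μ₁ μ₃ : Measure ℝ) (z w : ℂ) : ℂ := z * hTransform μ₁ ((hTilde μ₃ w)⁻¹ * z⁻¹)

/-- `[6 (2 v₁ + √(5 v₁² + 2 v₃ v₁))] ∨ [R + (3/2) √(R² + 4 R v₃)]`, with `v₁`, `v₃` variances. -/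
def boundK (v₁ v₃ R : ℝ) : ℝ :=
  max (6 * (2 * v₁ + √(5 * v₁ ^ 2 + 2 * v₃ * v₁))) (R + 3 / 2 * √(R ^ 2 + 4 * R * v₃))

/-- The constant `K`, as a function of the variances `v₁`, `v₃` and of the Jacobi parameters
`β = β₁`, `γ = γ₁`. -/
def constK (v₁ v₃ β γ : ℝ) : ℝ := boundK v₁ v₃ (max (2 * √γ) β)

end FreeDeconv

end

/-! If `F_μ₂` is to be recovered at `z`, put `w = ω₃(z)` and `ω = 1/(z h̃_{μ₃}(w))`. The convolution
relation says that `w = z h_{μ₁}(ω)`, a fixed point equation for `T_z`. Since `h_{μ₁}` tends to its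
mean `1` at infinity, `T_z` is a small perturbation of the constant `z` when `Im z` is large. The
work lies in making "large" explicit as `K`.

The analytic input is a bound `|h_{μ₁}(ω) - 1| |ω| ≤ 3σ₁²` at the points `ω` that occur. Write `h_μ
- m = v G_ν`. Away from a narrow sector around `[0,∞)`, positivity of the support suffices
(`norm_hTransform_mul_norm_le_of_sector`). Inside that sector `ω` may be close to the support, and
one expands `G_ν` one continued-fraction level further: `G_ν(ω)⁻¹` differs from `ω - β₁` by at most
`γ₁/|Im ω|` (`abs_im_mul_norm_hTransform_le`). This is where the fourth moment and the Jacobi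
parameters enter. The measure `ν` is never built: all estimates come from inner products with
`compressedResolvent` in `L²(μ)`. The geometry of `ω = (w²/z) · h_{μ₃}(w)⁻¹` shows that `|Im ω|` is
large enough for this (`le_abs_im_mul`). The two terms of `K` answer the two needs: the first makes
the image of the disc strictly smaller, the second gives the lower bound on `|Im ω|`.

Once `T_z` sends its disc into a strictly smaller concentric one (`norm_iterT_sub_le`), a strict
Schwarz–Pick lemma makes it a contraction with an explicit rate. The rate is locally uniform in `z`,
so `ω₃` is holomorphic. Along `u = -it`, `t → 0`, the inverses of the `η`-transforms produce fixed
points of `T_z` and the identity `F_{μ₂}(z) ω₃(z) = F_{μ₃}(ω₃(z)) z`; the identity theorem extends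
it to the whole half-plane. -/

namespace FreeDeconv

open Metric ComplexConjugate

/-! ### Strict Schwarz–Pick lemma and attracting fixed points in discs -/

/-- The contraction constant of a self-map of the unit disc with values in the disc of radius `κ`,
for the pseudo-hyperbolic distance. -/
noncomputable def contractionConst (κ : ℝ) : ℝ := √(1 - (1 - κ ^ 2) ^ 2 / 4)

lemma contractionConst_nonneg (κ : ℝ) : 0 ≤ contractionConst κ := Real.sqrt_nonneg _

lemma contractionConst_lt_one {κ : ℝ} (h0 : 0 ≤ κ) (h1 : κ < 1) : contractionConst κ < 1 := by
  have h : 0 < (1 - κ ^ 2) ^ 2 := by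
    have : 0 < 1 - κ ^ 2 := by nlinarith
    positivity
  rw [contractionConst, Real.sqrt_lt' one_pos]
  linarith

/-- The pseudo-hyperbolic distance on the unit disc. -/
noncomputable def pseudoDist (a b : ℂ) : ℝ := ‖(b - a) / (1 - conj a * b)‖

lemma normSq_one_sub_conj_mul (a b : ℂ) :
    ‖1 - conj a * b‖ ^ 2 - ‖b - a‖ ^ 2 = (1 - ‖a‖ ^ 2) * (1 - ‖b‖ ^ 2) := by
  simp only [← Complex.normSq_eq_norm_sq, Complex.normSq_apply]
  simp
  ring

lemma one_sub_conj_mul_ne_zero {a b : ℂ} (ha : ‖a‖ < 1) (hb : ‖b‖ < 1) : 1 - conj a * b ≠ 0 := by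
  intro h
  have h1 : ‖conj a * b‖ = 1 := by rw [← sub_eq_zero.mp h]; simp
  rw [norm_mul, RCLike.norm_conj] at h1
  nlinarith [norm_nonneg a, norm_nonneg b]

lemma norm_one_sub_conj_mul_lt_two {a b : ℂ} (ha : ‖a‖ < 1) (hb : ‖b‖ < 1) :
    ‖1 - conj a * b‖ < 2 := by
  have h1 : ‖1 - conj a * b‖ ≤ 1 + ‖a‖ * ‖b‖ := by
    refine (norm_sub_le _ _).trans ?_
    simp
  nlinarith [norm_nonneg a, norm_nonneg b]

lemma pseudoDist_sq {a b : ℂ} (ha : ‖a‖ < 1) (hb : ‖b‖ < 1) :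
    pseudoDist a b ^ 2 = 1 - (1 - ‖a‖ ^ 2) * (1 - ‖b‖ ^ 2) / ‖1 - conj a * b‖ ^ 2 := by
  have h := norm_pos_iff.mpr (one_sub_conj_mul_ne_zero ha hb)
  rw [← normSq_one_sub_conj_mul, pseudoDist, norm_div]
  generalize ‖1 - conj a * b‖ = d at h ⊢
  field_simp
  ring

lemma pseudoDist_lt_one {a b : ℂ} (ha : ‖a‖ < 1) (hb : ‖b‖ < 1) : pseudoDist a b < 1 := by
  have h := norm_pos_iff.mpr (one_sub_conj_mul_ne_zero ha hb)
  have h1 : 0 < 1 - ‖a‖ ^ 2 := by nlinarith [norm_nonneg a]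
  have h2 : 0 < 1 - ‖b‖ ^ 2 := by nlinarith [norm_nonneg b]
  have h3 : 0 < (1 - ‖a‖ ^ 2) * (1 - ‖b‖ ^ 2) / ‖1 - conj a * b‖ ^ 2 := by positivity
  have h4 := pseudoDist_sq ha hb
  have h5 : 0 ≤ pseudoDist a b := norm_nonneg _
  nlinarith

/-- In `1 - ρ² = (1 - |a|²)(1 - |b|²) / |1 - āb|²` the numerator is at least `(1 - κ²)²` and the
denominator is below `4`. -/
lemma pseudoDist_lt_contractionConst {κ : ℝ} (h1 : κ < 1) {a b : ℂ}
    (ha : ‖a‖ ≤ κ) (hb : ‖b‖ ≤ κ) : pseudoDist a b < contractionConst κ := by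
  have ha' : ‖a‖ < 1 := ha.trans_lt h1
  have hb' : ‖b‖ < 1 := hb.trans_lt h1
  have h := norm_pos_iff.mpr (one_sub_conj_mul_ne_zero ha' hb')
  have h2 := norm_one_sub_conj_mul_lt_two ha' hb'
  rw [contractionConst]
  apply Real.lt_sqrt_of_sq_lt
  rw [pseudoDist_sq ha' hb']
  have hκ : 0 < 1 - κ ^ 2 := by nlinarith [norm_nonneg a]
  have h3 : 1 - κ ^ 2 ≤ 1 - ‖a‖ ^ 2 := by nlinarith [norm_nonneg a]
  have h4 : 1 - κ ^ 2 ≤ 1 - ‖b‖ ^ 2 := by nlinarith [norm_nonneg b]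
  have h5 : (1 - κ ^ 2) ^ 2 ≤ (1 - ‖a‖ ^ 2) * (1 - ‖b‖ ^ 2) := by
    rw [sq]; exact mul_le_mul h3 h4 hκ.le (hκ.le.trans h3)
  have h6 : (1 - κ ^ 2) ^ 2 / 4 < (1 - ‖a‖ ^ 2) * (1 - ‖b‖ ^ 2) / ‖1 - conj a * b‖ ^ 2 := by
    rw [div_lt_div_iff₀ (by norm_num) (by positivity)]
    have h7 : ‖1 - conj a * b‖ ^ 2 < 4 := by nlinarith
    have h8 : 0 < (1 - κ ^ 2) ^ 2 := by positivity
    nlinarith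
  linarith

lemma norm_sub_le_two_mul_pseudoDist {a b : ℂ} (ha : ‖a‖ < 1) (hb : ‖b‖ < 1) :
    ‖b - a‖ ≤ 2 * pseudoDist a b := by
  have h := norm_pos_iff.mpr (one_sub_conj_mul_ne_zero ha hb)
  have h2 := norm_one_sub_conj_mul_lt_two ha hb
  have h3 : ‖b - a‖ = ‖1 - conj a * b‖ * pseudoDist a b := by
    rw [pseudoDist, norm_div, mul_div_cancel₀ _ h.ne']
  rw [h3]
  exact mul_le_mul_of_nonneg_right h2.le (norm_nonneg _)

/-- Strict form of the Schwarz–Pick lemma. -/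
lemma pseudoDist_map_le {f : ℂ → ℂ} {κ : ℝ} (h1 : κ < 1)
    (hf : DifferentiableOn ℂ f (ball 0 1)) (hm : ∀ u ∈ ball (0 : ℂ) 1, ‖f u‖ ≤ κ)
    {a b : ℂ} (ha : ‖a‖ < 1) (hb : ‖b‖ < 1) :
    pseudoDist (f a) (f b) ≤ contractionConst κ * pseudoDist a b := by
  have hna : ‖-a‖ < 1 := by rwa [norm_neg]
  -- Moving `a` and `f a` to the origin by disc automorphisms turns `f` into a map `g` fixing `0`
  -- with values in the disc of radius `contractionConst κ`; the Schwarz lemma for `g` is the claim.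
  set φ : ℂ → ℂ := fun u => (u - -a) / (1 - conj (-a) * u) with hφ
  have hφd : DifferentiableOn ℂ φ (ball 0 1) := by
    refine DifferentiableOn.div (by fun_prop) (by fun_prop) fun u hu => ?_
    exact one_sub_conj_mul_ne_zero hna (by simpa using hu)
  have hφm : Set.MapsTo φ (ball 0 1) (ball 0 1) := fun u hu => by
    have := pseudoDist_lt_one hna (b := u) (by simpa using hu)
    simpa [pseudoDist, φ] using this
  have hfa : ‖f a‖ ≤ κ := hm a (by simpa using ha)
  set g : ℂ → ℂ := fun u => (f (φ u) - f a) / (1 - conj (f a) * f (φ u)) with hg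
  have hgd : DifferentiableOn ℂ g (ball 0 1) := by
    have hc : DifferentiableOn ℂ (fun u => f (φ u)) (ball 0 1) := hf.comp hφd hφm
    refine DifferentiableOn.div (by fun_prop) (by fun_prop) fun u hu => ?_
    exact one_sub_conj_mul_ne_zero (hfa.trans_lt h1) ((hm _ (hφm hu)).trans_lt h1)
  have hφ0 : φ 0 = a := by simp [φ]
  have hg0 : g 0 = 0 := by simp [g, hφ0]
  have hgm : Set.MapsTo g (ball 0 1) (ball (g 0) (contractionConst κ)) := fun u hu => by
    have := pseudoDist_lt_contractionConst h1 hfa (hm _ (hφm hu))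
    simpa [hg0, pseudoDist, g] using this
  set u : ℂ := (b - a) / (1 - conj a * b) with hu
  have hub : u ∈ ball (0 : ℂ) 1 := by
    have := pseudoDist_lt_one ha hb
    simpa [pseudoDist, u] using this
  have hφu : φ u = b := by
    have h2 := one_sub_conj_mul_ne_zero ha hb
    have h4 := one_sub_conj_mul_ne_zero ha ha
    simp only [φ, map_neg, neg_mul, sub_neg_eq_add]
    clear_value u
    generalize conj a = a' at hu h2 h4 ⊢
    have h3 : 1 + a' * u = (1 - a' * a) / (1 - a' * b) := by
      rw [hu, eq_div_iff h2, add_mul, mul_assoc, div_mul_cancel₀ _ h2]; ring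
    have h5 : u + a = b * ((1 - a' * a) / (1 - a' * b)) := by
      rw [hu, ← mul_div_assoc, eq_div_iff h2, add_mul, div_mul_cancel₀ _ h2]; ring
    rw [h3, h5, mul_div_assoc, div_self (div_ne_zero h4 h2), mul_one]
  have key := Complex.dist_le_div_mul_dist_of_mapsTo_ball hgd
    (hgm.mono_right ball_subset_closedBall) hub
  have hgu : g u = (f b - f a) / (1 - conj (f a) * f b) := by simp only [g, hφu]
  rw [hg0, dist_zero_right, dist_zero_right, div_one, hgu] at key
  exact key

lemma norm_iterate_sub_iterate_le {f : ℂ → ℂ} {κ : ℝ} (h1 : κ < 1)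
    (hf : DifferentiableOn ℂ f (ball 0 1)) (hm : ∀ u ∈ ball (0 : ℂ) 1, ‖f u‖ ≤ κ)
    {a b : ℂ} (ha : ‖a‖ < 1) (hb : ‖b‖ < 1) (n : ℕ) :
    ‖f^[n] b - f^[n] a‖ ≤ 2 * contractionConst κ ^ n := by
  have hmaps : Set.MapsTo f (ball 0 1) (ball 0 1) := fun u hu => by
    simpa using (hm u hu).trans_lt h1
  have hit : ∀ x : ℂ, ‖x‖ < 1 → ∀ n, ‖f^[n] x‖ < 1 := fun x hx n => by
    have := hmaps.iterate n (x := x) (by simpa using hx)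
    simpa using this
  have hp : ∀ n, pseudoDist (f^[n] a) (f^[n] b) ≤ contractionConst κ ^ n := by
    intro n
    induction n with
    | zero => simpa using (pseudoDist_lt_one ha hb).le
    | succ n ih =>
      rw [Function.iterate_succ_apply', Function.iterate_succ_apply', pow_succ']
      exact (pseudoDist_map_le h1 hf hm (hit a ha n) (hit b hb n)).trans
        (mul_le_mul_of_nonneg_left ih (contractionConst_nonneg κ))
  exact (norm_sub_le_two_mul_pseudoDist (hit a ha n) (hit b hb n)).trans
    (mul_le_mul_of_nonneg_left (hp n) zero_le_two)

/-- An analytic self-map of the unit disc with values in a smaller disc has a fixed point that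
attracts all iterates geometrically. -/
lemma exists_fixedPoint_unitDisc {f : ℂ → ℂ} {κ : ℝ} (h0 : 0 ≤ κ) (h1 : κ < 1)
    (hf : DifferentiableOn ℂ f (ball 0 1)) (hm : ∀ u ∈ ball (0 : ℂ) 1, ‖f u‖ ≤ κ) :
    ∃ x, ‖x‖ < 1 ∧ f x = x ∧
      ∀ a : ℂ, ‖a‖ < 1 → ∀ n : ℕ, ‖f^[n] a - x‖ ≤ 2 * contractionConst κ ^ n := by
  have hmaps : Set.MapsTo f (ball 0 1) (ball 0 1) := fun u hu => by
    simpa using (hm u hu).trans_lt h1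
  have hz : ‖(0 : ℂ)‖ < 1 := by simp
  have hf0 : ‖f 0‖ < 1 := (hm 0 (by simp)).trans_lt h1
  have hcau : CauchySeq fun n => f^[n] 0 := by
    refine cauchySeq_of_le_geometric (contractionConst κ) 2 (contractionConst_lt_one h0 h1)
      fun n => ?_
    rw [dist_comm, dist_eq_norm, Function.iterate_succ_apply]
    exact norm_iterate_sub_iterate_le h1 hf hm hz hf0 n
  obtain ⟨x, hx⟩ := cauchySeq_tendsto_of_complete hcau
  have hx' := (tendsto_add_atTop_iff_nat 1).mpr hx
  have hxκ : ‖x‖ ≤ κ := by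
    refine le_of_tendsto hx'.norm (Eventually.of_forall fun n => ?_)
    rw [Function.iterate_succ_apply']
    exact hm _ (hmaps.iterate n (by simp))
  have hx1 : ‖x‖ < 1 := hxκ.trans_lt h1
  have hfx : f x = x := by
    have hc : ContinuousAt f x :=
      (hf.differentiableAt (isOpen_ball.mem_nhds (by simpa using hx1))).continuousAt
    have h3 := hc.tendsto.comp hx
    refine tendsto_nhds_unique (h3.congr fun n => ?_) hx'
    simp [Function.iterate_succ_apply']
  refine ⟨x, hx1, hfx, fun a ha n => ?_⟩
  have := norm_iterate_sub_iterate_le h1 hf hm hx1 ha n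
  rwa [Function.iterate_fixed hfx] at this

lemma exists_fixedPoint_ball {f : ℂ → ℂ} {c : ℂ} {R κ : ℝ} (hR : 0 < R) (h0 : 0 ≤ κ) (h1 : κ < 1)
    (hf : DifferentiableOn ℂ f (ball c R)) (hm : ∀ w ∈ ball c R, ‖f w - c‖ ≤ κ * R) :
    ∃ x ∈ ball c R, f x = x ∧
      ∀ a ∈ ball c R, ∀ n : ℕ, ‖f^[n] a - x‖ ≤ R * (2 * contractionConst κ ^ n) := by
  have hRc : (R : ℂ) ≠ 0 := by exact_mod_cast hR.ne'
  set e : ℂ → ℂ := fun u => c + R * u with he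
  set g : ℂ → ℂ := fun u => (f (e u) - c) / R with hg
  have hemaps : Set.MapsTo e (ball 0 1) (ball c R) := fun u hu => by
    rw [mem_ball_zero_iff] at hu
    simp only [e, mem_ball, dist_eq_norm, add_sub_cancel_left, norm_mul, Complex.norm_real,
      Real.norm_eq_abs, abs_of_pos hR]
    nlinarith
  have heg : ∀ u, e (g u) = f (e u) := fun u => by
    simp only [e, g]; field_simp; ring
  have hgd : DifferentiableOn ℂ g (ball 0 1) := by
    have hc : DifferentiableOn ℂ (fun u => f (e u)) (ball 0 1) :=
      hf.comp (by fun_prop) hemaps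
    fun_prop
  have hgm : ∀ u ∈ ball (0 : ℂ) 1, ‖g u‖ ≤ κ := fun u hu => by
    simp only [g, norm_div, Complex.norm_real, Real.norm_eq_abs, abs_of_pos hR]
    rw [div_le_iff₀ hR]
    exact hm _ (hemaps hu)
  obtain ⟨x, hx1, hgx, hit⟩ := exists_fixedPoint_unitDisc h0 h1 hgd hgm
  refine ⟨e x, hemaps (by simpa using hx1), by rw [← heg, hgx], fun a ha n => ?_⟩
  set b : ℂ := (a - c) / R with hb
  have heb : e b = a := by simp only [e, hb]; field_simp; ring
  have hb1 : ‖b‖ < 1 := by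
    rw [mem_ball, dist_eq_norm] at ha
    rw [hb, norm_div, Complex.norm_real, Real.norm_eq_abs, abs_of_pos hR, div_lt_one hR]
    exact ha
  have hsemi : f^[n] a = e (g^[n] b) := by
    rw [← heb]
    exact ((Function.Semiconj.iterate_right (f := e) (ga := g) (gb := f) heg n) b).symm
  have hsub : e (g^[n] b) - e x = R * (g^[n] b - x) := by simp only [e]; ring
  rw [hsemi, hsub, norm_mul, Complex.norm_real, Real.norm_eq_abs, abs_of_pos hR]
  exact mul_le_mul_of_nonneg_left (hit b hb1 n) hR.le

/-! ### The compressed resolvent and the first level of the continued fraction -/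

lemma sq_norm_integral_mul_le {α : Type*} [MeasurableSpace α] {μ : Measure α} {f g : α → ℂ}
    (hf : MemLp f 2 μ) (hg : MemLp g 2 μ) :
    ‖∫ x, f x * g x ∂μ‖ ^ 2 ≤ (∫ x, ‖f x‖ ^ 2 ∂μ) * ∫ x, ‖g x‖ ^ 2 ∂μ := by
  have h := integral_mul_norm_le_Lp_mul_Lq (μ := μ) (f := f) (g := g) Real.HolderConjugate.two_two
    (by simpa using hf) (by simpa using hg)
  have hA : 0 ≤ ∫ x, ‖f x‖ ^ 2 ∂μ := integral_nonneg fun x => by positivity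
  have hB : 0 ≤ ∫ x, ‖g x‖ ^ 2 ∂μ := integral_nonneg fun x => by positivity
  simp only [Real.rpow_two, ← Real.sqrt_eq_rpow] at h
  have h2 : ‖∫ x, f x * g x ∂μ‖ ≤ ∫ x, ‖f x‖ * ‖g x‖ ∂μ := by
    simpa only [norm_mul] using norm_integral_le_integral_norm (fun x => f x * g x) (μ := μ)
  calc ‖∫ x, f x * g x ∂μ‖ ^ 2
      ≤ (√(∫ x, ‖f x‖ ^ 2 ∂μ) * √(∫ x, ‖g x‖ ^ 2 ∂μ)) ^ 2 := by gcongr; exact h2.trans h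
    _ = _ := by rw [mul_pow, Real.sq_sqrt hA, Real.sq_sqrt hB]

/-- The function `F_μ(ω) / (ω - t) - 1`, equal to `(t - h_μ(ω)) / (ω - t)`: it is the resolvent at
`ω`, compressed to the orthogonal complement of the constants in `L²(μ)`, applied to `t`. -/
noncomputable def compressedResolvent (μ : Measure ℝ) (ω : ℂ) (t : ℝ) : ℂ := recipF μ ω * (ω - t)⁻¹ - 1

section Resolvent

variable {μ : Measure ℝ} {ω : ℂ} {δ : ℝ}

lemma norm_resolvent_le (hδ : 0 < δ) (hd : ∀ᵐ t : ℝ ∂μ, δ ≤ ‖ω - t‖) :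
    ∀ᵐ t : ℝ ∂μ, ‖(ω - t)⁻¹‖ ≤ δ⁻¹ := by
  filter_upwards [hd] with t ht
  rw [norm_inv]
  exact inv_anti₀ hδ ht

lemma measurable_compressedResolvent : Measurable (compressedResolvent μ ω) := by
  unfold compressedResolvent; fun_prop

/-- This is `(ω - t) ψ = t - h_μ(ω)` solved for `t ψ`; integrating it against suitable functions
yields the moment identities of `ψ`. -/
lemma mul_compressedResolvent (hδ : 0 < δ) (hd : ∀ᵐ t : ℝ ∂μ, δ ≤ ‖ω - t‖) :
    ∀ᵐ t : ℝ ∂μ, (t : ℂ) * compressedResolvent μ ω t =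
      ω * compressedResolvent μ ω t - (t - hTransform μ ω) := by
  filter_upwards [hd] with t ht
  have h : ω - t ≠ 0 := norm_pos_iff.mp (hδ.trans_le ht)
  have h2 : (ω - t) * compressedResolvent μ ω t = t - hTransform μ ω := by
    rw [compressedResolvent, hTransform, mul_sub, mul_left_comm, mul_inv_cancel₀ h]; ring
  linear_combination -h2

lemma exists_norm_compressedResolvent_le (hδ : 0 < δ) (hd : ∀ᵐ t : ℝ ∂μ, δ ≤ ‖ω - t‖) :
    ∃ C, ∀ᵐ t : ℝ ∂μ, ‖compressedResolvent μ ω t‖ ≤ C := by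
  refine ⟨‖recipF μ ω‖ * δ⁻¹ + 1, ?_⟩
  filter_upwards [norm_resolvent_le hδ hd] with t ht
  refine (norm_sub_le _ _).trans ?_
  rw [norm_mul, norm_one]
  gcongr

lemma integrable_mul_compressedResolvent (hδ : 0 < δ) (hd : ∀ᵐ t : ℝ ∂μ, δ ≤ ‖ω - t‖) {f : ℝ → ℂ}
    (hf : Integrable f μ) : Integrable (fun t => f t * compressedResolvent μ ω t) μ := by
  obtain ⟨C, hC⟩ := exists_norm_compressedResolvent_le hδ hd
  exact hf.mul_bdd measurable_compressedResolvent.aestronglyMeasurable hC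

lemma integrable_mul_conj_compressedResolvent (hδ : 0 < δ) (hd : ∀ᵐ t : ℝ ∂μ, δ ≤ ‖ω - t‖)
    {f : ℝ → ℂ} (hf : Integrable f μ) :
    Integrable (fun t => f t * conj (compressedResolvent μ ω t)) μ := by
  obtain ⟨C, hC⟩ := exists_norm_compressedResolvent_le hδ hd
  refine hf.mul_bdd (c := C) ?_ (by simpa only [RCLike.norm_conj] using hC)
  exact (RCLike.continuous_conj.measurable.comp
    measurable_compressedResolvent).aestronglyMeasurable

variable [IsProbabilityMeasure μ]

lemma integrable_resolvent (hδ : 0 < δ) (hd : ∀ᵐ t : ℝ ∂μ, δ ≤ ‖ω - t‖) :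
    Integrable (fun t : ℝ => (ω - t)⁻¹) μ :=
  Integrable.of_bound (by fun_prop) δ⁻¹ (norm_resolvent_le hδ hd)

lemma memLp_compressedResolvent (hδ : 0 < δ) (hd : ∀ᵐ t : ℝ ∂μ, δ ≤ ‖ω - t‖) :
    MemLp (compressedResolvent μ ω) 2 μ := by
  obtain ⟨C, hC⟩ := exists_norm_compressedResolvent_le hδ hd
  exact MemLp.of_bound measurable_compressedResolvent.aestronglyMeasurable C hC

lemma integral_compressedResolvent (hδ : 0 < δ) (hd : ∀ᵐ t : ℝ ∂μ, δ ≤ ‖ω - t‖)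
    (hG : cauchyG μ ω ≠ 0) : ∫ t, compressedResolvent μ ω t ∂μ = 0 := by
  have h1 : ∫ t : ℝ, (ω - t)⁻¹ ∂μ = cauchyG μ ω := rfl
  unfold compressedResolvent
  rw [integral_sub ((integrable_resolvent hδ hd).const_mul _) (integrable_const _),
    integral_const_mul, h1, recipF, inv_mul_cancel₀ hG]
  simp

lemma integral_mul_compressedResolvent (hδ : 0 < δ) (hd : ∀ᵐ t : ℝ ∂μ, δ ≤ ‖ω - t‖)
    (hG : cauchyG μ ω ≠ 0) {m : ℝ} (hi : Integrable (fun t : ℝ => t) μ) (hm : ∫ t, t ∂μ = m) :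
    ∫ t : ℝ, (t : ℂ) * compressedResolvent μ ω t ∂μ = hTransform μ ω - m := by
  have hψ : Integrable (compressedResolvent μ ω) μ :=
    (memLp_compressedResolvent hδ hd).integrable (by norm_num)
  have hi' : Integrable (fun t : ℝ => (t : ℂ)) μ := hi.ofReal
  rw [integral_congr_ae (mul_compressedResolvent hδ hd),
    integral_sub (hψ.const_mul _) (g := fun t : ℝ => (t : ℂ) - hTransform μ ω)
      (hi'.sub (integrable_const _)), integral_const_mul,
    integral_compressedResolvent hδ hd hG, integral_sub hi' (integrable_const _),
    integral_complex_ofReal, hm]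
  simp

lemma integral_centred_mul_compressedResolvent (hδ : 0 < δ) (hd : ∀ᵐ t : ℝ ∂μ, δ ≤ ‖ω - t‖)
    (hG : cauchyG μ ω ≠ 0) {m : ℝ} (hi : Integrable (fun t : ℝ => t) μ) (hm : ∫ t, t ∂μ = m) :
    ∫ t : ℝ, ((t - m : ℝ) : ℂ) * compressedResolvent μ ω t ∂μ = hTransform μ ω - m := by
  have hi' : Integrable (fun t : ℝ => (t : ℂ)) μ := hi.ofReal
  have hψ : Integrable (compressedResolvent μ ω) μ :=
    (memLp_compressedResolvent hδ hd).integrable (by norm_num)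
  simp only [Complex.ofReal_sub, sub_mul]
  rw [integral_sub (integrable_mul_compressedResolvent hδ hd hi') (hψ.const_mul _),
    integral_mul_compressedResolvent hδ hd hG hi hm, integral_const_mul,
    integral_compressedResolvent hδ hd hG]
  simp

/-- Multiply `(ω - t) ψ = t - h` by `conj ψ` and integrate; the term in `h` drops out since `∫ ψ =
0`. -/
lemma integral_sub_mul_normSq_compressedResolvent (hδ : 0 < δ) (hd : ∀ᵐ t : ℝ ∂μ, δ ≤ ‖ω - t‖)
    (hG : cauchyG μ ω ≠ 0) {m : ℝ} (hi : Integrable (fun t : ℝ => t) μ) (hm : ∫ t, t ∂μ = m) :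
    conj (hTransform μ ω - m) = ω * (∫ t, ‖compressedResolvent μ ω t‖ ^ 2 ∂μ : ℝ) -
      (∫ t, t * ‖compressedResolvent μ ω t‖ ^ 2 ∂μ : ℝ) := by
  have hi' : Integrable (fun t : ℝ => (t : ℂ)) μ := hi.ofReal
  have hψ : Integrable (compressedResolvent μ ω) μ :=
    (memLp_compressedResolvent hδ hd).integrable (by norm_num)
  have hsq : ∀ t, ((‖compressedResolvent μ ω t‖ ^ 2 : ℝ) : ℂ) =
      compressedResolvent μ ω t * conj (compressedResolvent μ ω t) := fun t => by
    rw [RCLike.mul_conj]; simp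
  have e1 : ∫ t : ℝ, conj ((t : ℂ) * compressedResolvent μ ω t) ∂μ =
      conj (hTransform μ ω - m) := by
    rw [integral_conj, integral_mul_compressedResolvent hδ hd hG hi hm]
  have e0 : ∫ t : ℝ, conj (compressedResolvent μ ω t) ∂μ = 0 := by
    rw [integral_conj, integral_compressedResolvent hδ hd hG, map_zero]
  rw [← integral_complex_ofReal, ← integral_complex_ofReal]
  simp only [Complex.ofReal_mul, hsq]
  rw [← integral_const_mul, ← integral_sub
    ((integrable_mul_conj_compressedResolvent hδ hd hψ).const_mul _)]
  · have e2 : ∀ᵐ t : ℝ ∂μ, ω * (compressedResolvent μ ω t * conj (compressedResolvent μ ω t)) -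
        t * (compressedResolvent μ ω t * conj (compressedResolvent μ ω t)) =
        conj ((t : ℂ) * compressedResolvent μ ω t) -
          hTransform μ ω * conj (compressedResolvent μ ω t) := by
      filter_upwards [mul_compressedResolvent hδ hd] with t ht
      rw [map_mul, Complex.conj_ofReal]
      linear_combination (-conj (compressedResolvent μ ω t)) * ht
    rw [integral_congr_ae e2, integral_sub, e1, integral_const_mul, e0]
    · simp
    · have := integrable_mul_conj_compressedResolvent hδ hd hi'
      simpa only [map_mul, Complex.conj_ofReal] using this
    · exact integrable_mul_conj_compressedResolvent hδ hd (integrable_const _)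
  · have := integrable_mul_conj_compressedResolvent hδ hd
      (integrable_mul_compressedResolvent hδ hd hi')
    simpa only [mul_assoc] using this

/-- `h_μ(ω) - m = v G_ν(ω)` for a probability measure `ν`; the numbers `N` and `p` stand for
`v ∫ |ω - t|⁻² dν` and `v ∫ t |ω - t|⁻² dν`. -/
lemma hTransform_sub_mean (hδ : 0 < δ) (hd : ∀ᵐ t : ℝ ∂μ, δ ≤ ‖ω - t‖)
    (hG : cauchyG μ ω ≠ 0) (hmom : MemLp (id : ℝ → ℝ) 2 μ) :
    ∃ N p : ℝ, 0 ≤ N ∧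
      ‖hTransform μ ω - (∫ t, t ∂μ : ℝ)‖ ^ 2 ≤ variance id μ * N ∧
      conj (hTransform μ ω - (∫ t, t ∂μ : ℝ)) = ω * N - p ∧
      ((∀ᵐ t ∂μ, 0 ≤ t) → 0 ≤ p) := by
  have hi : Integrable (fun t : ℝ => t) μ := hmom.integrable (by norm_num)
  refine ⟨_, _, integral_nonneg fun t => by positivity, ?_,
    integral_sub_mul_normSq_compressedResolvent hδ hd hG hi rfl, fun h0 => ?_⟩
  · have ha : MemLp (fun t : ℝ => ((t - ∫ t, t ∂μ : ℝ) : ℂ)) 2 μ :=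
      (hmom.sub (memLp_const _)).ofReal
    have h := sq_norm_integral_mul_le ha (memLp_compressedResolvent (ω := ω) hδ hd)
    rw [variance_eq_integral aemeasurable_id]
    rw [integral_centred_mul_compressedResolvent hδ hd hG hi rfl] at h
    simpa only [Complex.norm_real, Real.norm_eq_abs, sq_abs, id] using h
  · refine integral_nonneg_of_ae ?_
    filter_upwards [h0] with t ht
    positivity

/-- With `N = ∫ |ω - t|⁻²` and `p = ∫ t |ω - t|⁻²` one has `conj G = ω N - p`. A zero of `G` would
thus be the real number `p / N`, nonnegative when the support is. -/
lemma cauchyG_ne_zero (hδ : 0 < δ) (hd : ∀ᵐ t : ℝ ∂μ, δ ≤ ‖ω - t‖)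
    (h : ω.im ≠ 0 ∨ ((∀ᵐ t ∂μ, 0 ≤ t) ∧ ω ∈ slitPlanePos)) (hi : Integrable (fun t : ℝ => t) μ) :
    cauchyG μ ω ≠ 0 := by
  intro hG
  set N : ℝ := ∫ t : ℝ, ‖(ω - t)⁻¹‖ ^ 2 ∂μ with hN
  set p : ℝ := ∫ t : ℝ, t * ‖(ω - t)⁻¹‖ ^ 2 ∂μ with hp
  have hb : ∀ᵐ t : ℝ ∂μ, ‖‖(ω - t)⁻¹‖ ^ 2‖ ≤ δ⁻¹ ^ 2 := by
    filter_upwards [norm_resolvent_le hδ hd] with t ht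
    rw [Real.norm_of_nonneg (by positivity)]
    gcongr
  have hm : AEStronglyMeasurable (fun t : ℝ => ‖(ω - t)⁻¹‖ ^ 2) μ := by
    apply Measurable.aestronglyMeasurable; fun_prop
  have hNi : Integrable (fun t : ℝ => ‖(ω - t)⁻¹‖ ^ 2) μ := Integrable.of_bound hm _ hb
  have hpi : Integrable (fun t : ℝ => t * ‖(ω - t)⁻¹‖ ^ 2) μ := hi.mul_bdd hm hb
  have hNpos : 0 < N := by
    refine (integral_pos_iff_support_of_nonneg_ae (ae_of_all _ fun t => by positivity) hNi).mpr ?_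
    have : ∀ᵐ t : ℝ ∂μ, t ∈ Function.support fun t : ℝ => ‖(ω - t)⁻¹‖ ^ 2 := by
      filter_upwards [hd] with t ht
      have h0 : ω - t ≠ 0 := norm_pos_iff.mp (hδ.trans_le ht)
      simpa using h0
    have h1 : (Function.support fun t : ℝ => ‖(ω - t)⁻¹‖ ^ 2) =ᵐ[μ] Set.univ :=
      eventuallyEq_univ.mpr this
    rw [measure_congr h1]
    simp
  have key : conj (cauchyG μ ω) = ω * N - p := by
    rw [hN, hp, ← integral_complex_ofReal, ← integral_complex_ofReal, ← integral_const_mul,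
      ← integral_sub (hNi.ofReal.const_mul _) hpi.ofReal, cauchyG, ← integral_conj]
    refine integral_congr_ae ?_
    filter_upwards [hd] with t ht
    have h0 : ω - t ≠ 0 := norm_pos_iff.mp (hδ.trans_le ht)
    have h1 : ((‖(ω - t)⁻¹‖ ^ 2 : ℝ) : ℂ) = (ω - t)⁻¹ * conj (ω - t)⁻¹ := by
      rw [RCLike.mul_conj]; simp
    simp only [Complex.ofReal_mul, h1]
    rw [← sub_mul, ← mul_assoc, mul_inv_cancel₀ h0, one_mul]
  rw [hG, map_zero] at key
  have him : ω.im = 0 := by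
    have := congrArg Complex.im key
    simp at this
    exact this.resolve_right hNpos.ne'
  rcases h with h | ⟨hs, h⟩
  · exact h him
  · refine h ⟨him, ?_⟩
    have hp0 : 0 ≤ p := integral_nonneg_of_ae (by
      filter_upwards [hs] with t ht
      positivity)
    have := congrArg Complex.re key
    simp at this
    by_contra! hneg
    nlinarith

end Resolvent

/-! ### The second level of the continued fraction -/

/-- If `h_μ(ω) - m = v G_ν(ω)` with `ν` of mean `β` and variance `γ`, then
`G_ν(ω)⁻¹ = ω - β - γ G(ω)` for the Cauchy transform `G` of a third probability measure. -/
lemma abs_im_mul_norm_hTransform_le {μ : Measure ℝ} [IsProbabilityMeasure μ] {ω : ℂ} {δ : ℝ}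
    (hδ : 0 < δ) (hd : ∀ᵐ t : ℝ ∂μ, δ ≤ ‖ω - t‖) (hG : cauchyG μ ω ≠ 0)
    (hmom : MemLp (id : ℝ → ℝ) 4 μ) {m v β γ : ℝ} (hm : ∫ t, t ∂μ = m) (hvpos : 0 < v)
    (hv : ∫ t, (t - m) ^ 2 ∂μ = v) (hβ : ∫ t, t * (t - m) ^ 2 ∂μ = β * v)
    (hγ : ∫ t, ((t - β) * (t - m) - v) ^ 2 ∂μ = γ * v) :
    |ω.im| * ‖(hTransform μ ω - m) * (ω - β) - v‖ ≤ γ * ‖hTransform μ ω - m‖ := by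
  have L1 : MemLp (fun t : ℝ => t) 2 μ := hmom.mono_exponent (by norm_num)
  have L2 : MemLp (fun t : ℝ => t ^ 2) 2 μ := by
    rw [memLp_two_iff_integrable_sq_norm (by fun_prop)]
    have := hmom.integrable_norm_pow (p := 4) (by norm_num)
    refine this.congr (ae_of_all _ fun t => ?_)
    simp only [id, norm_pow, ← pow_mul]
  have hi : Integrable (fun t : ℝ => t) μ := L1.integrable (by norm_num)
  have LA : MemLp (fun t : ℝ => t - m) 2 μ := L1.sub (memLp_const m)
  have LP : MemLp (fun t : ℝ => (t - β) * (t - m) - v) 2 μ := by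
    have : MemLp (fun t : ℝ => t ^ 2 - (β + m) * t + (β * m - v)) 2 μ :=
      (L2.sub (L1.const_mul _)).add (memLp_const _)
    refine this.ae_eq (ae_of_all _ fun t => ?_)
    ring
  have LTA : MemLp (fun t : ℝ => t * (t - m)) 2 μ := by
    have : MemLp (fun t : ℝ => t ^ 2 - m * t) 2 μ := L2.sub (L1.const_mul _)
    refine this.ae_eq (ae_of_all _ fun t => ?_)
    ring
  have LA' : MemLp (fun t : ℝ => ((t - m : ℝ) : ℂ)) 2 μ := LA.ofReal
  have LP' : MemLp (fun t : ℝ => (((t - β) * (t - m) - v : ℝ) : ℂ)) 2 μ := LP.ofReal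
  have Lψ := memLp_compressedResolvent (μ := μ) (ω := ω) hδ hd
  set g : ℂ := hTransform μ ω - m with hg
  have hvc : (v : ℂ) ≠ 0 := by exact_mod_cast hvpos.ne'
  set ψ := compressedResolvent μ ω with hψ
  set A : ℝ → ℂ := fun t => ((t - m : ℝ) : ℂ) with hA
  set P : ℝ → ℂ := fun t => (((t - β) * (t - m) - v : ℝ) : ℂ) with hP
  have Iψ : Integrable ψ μ := Lψ.integrable (by norm_num)
  have IA : Integrable A μ := LA'.integrable (by norm_num)
  have IAψ : Integrable (fun t => A t * ψ t) μ := LA'.integrable_mul Lψ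
  have IAA : Integrable (fun t => A t * A t) μ := LA'.integrable_mul LA'
  have jA : ∫ t, A t ∂μ = 0 := by
    simp only [A]
    rw [integral_complex_ofReal, integral_sub hi (integrable_const _), hm]
    simp
  have jAA : ∫ t, A t * A t ∂μ = v := by
    simp only [A, ← Complex.ofReal_mul]
    rw [integral_complex_ofReal, ← hv]
    simp only [sq]
  have jψ : ∫ t, ψ t ∂μ = 0 := integral_compressedResolvent hδ hd hG
  have jAψ : ∫ t, A t * ψ t ∂μ = g := integral_centred_mul_compressedResolvent hδ hd hG hi hm
  -- `A` and `P` are the monic orthogonal polynomials of degrees one and two; this orthogonality is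
  -- what the choice of `β` encodes.
  have jPA : ∫ t, P t * A t ∂μ = 0 := by
    simp only [A, P, ← Complex.ofReal_mul]
    rw [integral_complex_ofReal]
    have e : ∀ t : ℝ, ((t - β) * (t - m) - v) * (t - m) =
        t * (t - m) * (t - m) - β * ((t - m) * (t - m)) - v * (t - m) := fun t => by ring
    simp only [e]
    have i1 : Integrable (fun t : ℝ => t * (t - m) * (t - m)) μ := LTA.integrable_mul LA
    have i2 : Integrable (fun t : ℝ => (t - m) * (t - m)) μ := LA.integrable_mul LA
    have i3 : Integrable (fun t : ℝ => t - m) μ := LA.integrable (by norm_num)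
    have i12 : Integrable (fun t : ℝ => t * (t - m) * (t - m) - β * ((t - m) * (t - m))) μ :=
      i1.sub (i2.const_mul β)
    rw [integral_sub i12 (i3.const_mul v), integral_sub i1 (i2.const_mul β),
      integral_const_mul, integral_const_mul, integral_sub hi (integrable_const _), hm]
    simp only [mul_assoc, ← sq, hv, hβ]
    simp
  have jPψ : ∫ t, P t * ψ t ∂μ = g * (ω - β) - v := by
    have e : ∀ᵐ t : ℝ ∂μ, P t * ψ t =
        (ω - β) * (A t * ψ t) - A t * A t + (g * A t - v * ψ t) := by
      filter_upwards [mul_compressedResolvent hδ hd] with t ht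
      simp only [P, A, hg]
      push_cast
      linear_combination ((t : ℂ) - m) * ht
    have i1 : Integrable (fun t => (ω - β) * (A t * ψ t) - A t * A t) μ :=
      (IAψ.const_mul _).sub IAA
    have i2 : Integrable (fun t => g * A t - v * ψ t) μ := (IA.const_mul _).sub (Iψ.const_mul _)
    rw [integral_congr_ae e, integral_add i1 i2, integral_sub (IAψ.const_mul _) IAA,
      integral_sub (IA.const_mul _) (Iψ.const_mul _)]
    simp only [integral_const_mul, jAψ, jAA, jA, jψ]
    ring
  -- Removing from `ψ` its component along `A` compresses the resolvent a second time, now to the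
  -- complement of `1` and `A`.
  set φ : ℝ → ℂ := fun t => ψ t - g / v * A t with hφ
  have Lφ : MemLp φ 2 μ := Lψ.sub (LA'.const_mul _)
  have Lφc : MemLp (fun t => conj (φ t)) 2 μ := Lφ.star
  have jAφ : ∫ t, A t * φ t ∂μ = 0 := by
    have e : ∀ t, A t * φ t = A t * ψ t - g / v * (A t * A t) := fun t => by simp only [φ]; ring
    simp only [e]
    rw [integral_sub IAψ (IAA.const_mul _), integral_const_mul, jAψ, jAA]
    field_simp
    ring
  have jPφ : ∫ t, P t * φ t ∂μ = g * (ω - β) - v := by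
    have e : ∀ t, P t * φ t = P t * ψ t - g / v * (P t * A t) := fun t => by simp only [φ]; ring
    have i1 : Integrable (fun t => P t * ψ t) μ := LP'.integrable_mul Lψ
    have i2 : Integrable (fun t => P t * A t) μ := LP'.integrable_mul LA'
    simp only [e]
    rw [integral_sub i1 (i2.const_mul _), integral_const_mul, jPψ, jPA]
    simp
  have cA : ∀ t, conj (A t) = A t := fun t => Complex.conj_ofReal _
  have cP : ∀ t, conj (P t) = P t := fun t => Complex.conj_ofReal _
  have jAφc : ∫ t, A t * conj (φ t) ∂μ = 0 := by
    have : ∫ t, conj (A t * φ t) ∂μ = 0 := by rw [integral_conj, jAφ, map_zero]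
    simpa only [map_mul, cA] using this
  have jPφc : ∫ t, P t * conj (φ t) ∂μ = conj (g * (ω - β) - v) := by
    rw [← jPφ, ← integral_conj]
    simp only [map_mul, cP]
  set E : ℂ := g * (ω - β) - v with hE
  have i1 : Integrable (fun t => A t * conj (φ t)) μ := LA'.integrable_mul Lφc
  have i2 : Integrable (fun t => P t * conj (φ t)) μ := LP'.integrable_mul Lφc
  -- As at the first level, `(ω - t) φ` is paired with `conj φ`. It is a combination of `A` and `P`,
  -- and `A` is orthogonal to `φ`, so only the pairing with `P` survives.
  have hM : ω.im * ∫ t, ‖φ t‖ ^ 2 ∂μ = (g / v * conj E).im := by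
    have e : ∀ᵐ t : ℝ ∂μ, ω.im * ‖φ t‖ ^ 2 = RCLike.im
        ((1 - g / v * (ω - β)) * (A t * conj (φ t)) + g / v * (P t * conj (φ t))) := by
      filter_upwards [mul_compressedResolvent hδ hd] with t ht
      have h1 : ((‖φ t‖ ^ 2 : ℝ) : ℂ) = φ t * conj (φ t) := by rw [RCLike.mul_conj]; simp
      have h2 : (ω - t) * ((‖φ t‖ ^ 2 : ℝ) : ℂ) = (1 - g / v * (ω - β)) * (A t * conj (φ t)) +
          g / v * (P t * conj (φ t)) := by
        rw [h1]
        have h3 : (ω - t) * φ t = (1 - g / v * (ω - β)) * A t + g / v * P t := by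
          simp only [φ, P, A, hg]
          push_cast
          field_simp
          linear_combination (-(v : ℂ)) * ht
        linear_combination (conj (φ t)) * h3
      rw [← h2]
      simp [-Complex.ofReal_pow]
    rw [← integral_const_mul, integral_congr_ae e, integral_im]
    · rw [integral_add (i1.const_mul _) (i2.const_mul _), integral_const_mul, integral_const_mul,
        jAφc, jPφc]
      simp
    · exact (i1.const_mul _).add (i2.const_mul _)
  have hCS := sq_norm_integral_mul_le LP' Lφ
  rw [jPφ] at hCS
  have hPn : ∫ t, ‖P t‖ ^ 2 ∂μ = γ * v := by
    rw [← hγ]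
    simp only [P, Complex.norm_real, Real.norm_eq_abs, sq_abs]
  rw [hPn] at hCS
  set M := ∫ t, ‖φ t‖ ^ 2 ∂μ with hMdef
  have hM0 : 0 ≤ M := integral_nonneg fun t => by positivity
  have hγ0 : 0 ≤ γ := by
    have : 0 ≤ γ * v := hγ ▸ integral_nonneg fun t => by positivity
    exact nonneg_of_mul_nonneg_left this hvpos
  have h1 : |ω.im| * M * v ≤ ‖g‖ * ‖E‖ := by
    have h2 : |ω.im| * M ≤ ‖g‖ / v * ‖E‖ := by
      rw [← abs_of_nonneg hM0, ← abs_mul, hM]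
      refine (Complex.abs_im_le_norm _).trans ?_
      simp [abs_of_pos hvpos]
    calc _ ≤ ‖g‖ / v * ‖E‖ * v := by gcongr
      _ = _ := by field_simp
  -- Cauchy–Schwarz gives `|E|² ≤ γ v M`, while `h1` bounds `|Im ω| M v` by `|g| |E|`; combine and
  -- cancel one factor `|E|`.
  rcases (norm_nonneg E).eq_or_lt with h0 | h0
  · rw [← h0, mul_zero]; positivity
  · refine le_of_mul_le_mul_right ?_ h0
    calc |ω.im| * ‖E‖ * ‖E‖ = |ω.im| * ‖E‖ ^ 2 := by ring
      _ ≤ |ω.im| * (γ * v * M) := by gcongr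
      _ = γ * (|ω.im| * M * v) := by ring
      _ ≤ γ * (‖g‖ * ‖E‖) := by gcongr
      _ = _ := by ring

/-! ### Domains and holomorphy of the transforms -/

/-- `ω` keeps a positive distance from almost all points for `μ`. -/
def AwayFrom (μ : Measure ℝ) (ω : ℂ) : Prop := ∃ δ > 0, ∀ᵐ t : ℝ ∂μ, δ ≤ ‖ω - t‖

lemma awayFrom_of_im_ne_zero {μ : Measure ℝ} {ω : ℂ} (h : ω.im ≠ 0) : AwayFrom μ ω := by
  refine ⟨|ω.im|, abs_pos.mpr h, ae_of_all _ fun t => ?_⟩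
  simpa using Complex.abs_im_le_norm (ω - t)

lemma isOpen_slitPlanePos : IsOpen slitPlanePos := by
  have : slitPlanePos = (({w : ℂ | w.im = 0} ∩ {w : ℂ | 0 ≤ w.re})ᶜ) := rfl
  rw [this, isOpen_compl_iff]
  exact (isClosed_eq Complex.continuous_im continuous_const).inter
    (isClosed_le continuous_const Complex.continuous_re)

lemma awayFrom_of_mem_slitPlanePos {μ : Measure ℝ} (hsupp : ∀ᵐ t ∂μ, 0 ≤ t) {ω : ℂ}
    (h : ω ∈ slitPlanePos) : AwayFrom μ ω := by
  obtain ⟨δ, hδ, hb⟩ := Metric.isOpen_iff.mp isOpen_slitPlanePos ω h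
  refine ⟨δ, hδ, ?_⟩
  filter_upwards [hsupp] with t ht
  by_contra! hlt
  have : (t : ℂ) ∈ ball ω δ := by rwa [mem_ball, dist_comm, dist_eq_norm]
  exact hb this ⟨by simp, by simpa using ht⟩

section Differentiability

variable {μ : Measure ℝ} [IsProbabilityMeasure μ] {ω : ℂ}

lemma differentiableAt_cauchyG (h : AwayFrom μ ω) : DifferentiableAt ℂ (cauchyG μ) ω := by
  obtain ⟨δ, hδ, hd⟩ := h
  have hδ2 : 0 < δ / 2 := by positivity
  have hnear : ∀ᵐ t : ℝ ∂μ, ∀ x ∈ ball ω (δ / 2), δ / 2 ≤ ‖x - t‖ := by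
    filter_upwards [hd] with t ht x hx
    have h1 : ‖ω - t‖ ≤ ‖x - ω‖ + ‖x - t‖ := by
      rw [norm_sub_rev x ω]
      simpa using norm_add_le (ω - x) (x - t)
    rw [mem_ball, dist_eq_norm] at hx
    linarith
  refine (hasDerivAt_integral_of_dominated_loc_of_deriv_le (μ := μ)
    (F := fun (z : ℂ) (t : ℝ) => (z - (t : ℂ))⁻¹) (F' := fun z t => -((z - t) ^ 2)⁻¹)
    (bound := fun _ => ((δ / 2) ^ 2)⁻¹) (ball_mem_nhds ω hδ2)
    (Eventually.of_forall fun z => by fun_prop) (integrable_resolvent hδ hd)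
    (by fun_prop) ?_ (integrable_const _) ?_).2.differentiableAt
  · filter_upwards [hnear] with t ht x hx
    rw [norm_neg, norm_inv, norm_pow]
    have := ht x hx
    gcongr
  · filter_upwards [hnear] with t ht x hx
    have h0 : x - t ≠ 0 := norm_pos_iff.mp (hδ2.trans_le (ht x hx))
    exact (((hasDerivAt_id x).sub_const (t : ℂ)).inv h0).congr_deriv (by simp [neg_div])

lemma differentiableAt_recipF (h : AwayFrom μ ω) (hG : cauchyG μ ω ≠ 0) :
    DifferentiableAt ℂ (recipF μ) ω := (differentiableAt_cauchyG h).inv hG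

lemma differentiableAt_hTransform (h : AwayFrom μ ω) (hG : cauchyG μ ω ≠ 0) :
    DifferentiableAt ℂ (hTransform μ) ω := differentiableAt_id.sub (differentiableAt_recipF h hG)

end Differentiability

/-! ### Bounds on `h_μ` minus its mean -/

section HalfPlane

variable {μ : Measure ℝ} [IsProbabilityMeasure μ] {ω : ℂ}

lemma cauchyG_ne_zero_of_im_ne_zero (hω : ω.im ≠ 0) (hi : Integrable (fun t : ℝ => t) μ) :
    cauchyG μ ω ≠ 0 := by
  obtain ⟨δ, hδ, hd⟩ := awayFrom_of_im_ne_zero (μ := μ) hω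
  exact cauchyG_ne_zero hδ hd (Or.inl hω) hi

lemma cauchyG_ne_zero_of_mem_slitPlanePos (hsupp : ∀ᵐ t ∂μ, 0 ≤ t) (hω : ω ∈ slitPlanePos)
    (hi : Integrable (fun t : ℝ => t) μ) : cauchyG μ ω ≠ 0 := by
  obtain ⟨δ, hδ, hd⟩ := awayFrom_of_mem_slitPlanePos hsupp hω
  exact cauchyG_ne_zero hδ hd (Or.inr ⟨hsupp, hω⟩) hi

lemma integrable_of_memLp_two (hmom : MemLp (id : ℝ → ℝ) 2 μ) : Integrable (fun t : ℝ => t) μ :=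
  hmom.integrable (by norm_num)

/-- Finer than a bound on the modulus: it places `h_μ(ω) - m` in a disc of diameter `v / Im ω` below
the real axis and tangent to it at `0`. The tangency later keeps `ω₁` off `[0,∞)`. -/
lemma sq_norm_hTransform_mul_im_le (hmom : MemLp (id : ℝ → ℝ) 2 μ) (hω : 0 < ω.im) :
    ‖hTransform μ ω - (∫ t, t ∂μ : ℝ)‖ ^ 2 * ω.im ≤
      variance id μ * -(hTransform μ ω - (∫ t, t ∂μ : ℝ)).im := by
  obtain ⟨δ, hδ, hd⟩ := awayFrom_of_im_ne_zero (μ := μ) hω.ne'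
  obtain ⟨N, p, hN, h1, h2, -⟩ := hTransform_sub_mean hδ hd
    (cauchyG_ne_zero_of_im_ne_zero hω.ne' (integrable_of_memLp_two hmom)) hmom
  have h3 := congrArg Complex.im h2
  rw [Complex.conj_im, Complex.sub_im (ω * N), Complex.im_mul_ofReal, Complex.ofReal_im, sub_zero] at h3
  rw [h3]
  nlinarith

lemma norm_hTransform_mul_im_le (hmom : MemLp (id : ℝ → ℝ) 2 μ) (hω : ω.im ≠ 0) :
    ‖hTransform μ ω - (∫ t, t ∂μ : ℝ)‖ * |ω.im| ≤ variance id μ := by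
  obtain ⟨δ, hδ, hd⟩ := awayFrom_of_im_ne_zero (μ := μ) hω
  obtain ⟨N, p, hN, h1, h2, -⟩ := hTransform_sub_mean hδ hd
    (cauchyG_ne_zero_of_im_ne_zero hω (integrable_of_memLp_two hmom)) hmom
  have h3 := congrArg Complex.im h2
  rw [Complex.conj_im, Complex.sub_im (ω * N), Complex.im_mul_ofReal, Complex.ofReal_im, sub_zero] at h3
  set g := hTransform μ ω - (∫ t, t ∂μ : ℝ)
  have h4 : |ω.im| * N ≤ ‖g‖ := by
    rw [← abs_of_nonneg hN, ← abs_mul, ← h3, abs_neg]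
    exact Complex.abs_im_le_norm g
  have hv := variance_nonneg id μ
  rcases (norm_nonneg g).eq_or_lt with h0 | h0
  · rw [← h0, zero_mul]; exact hv
  · refine le_of_mul_le_mul_right ?_ h0
    have h5 := mul_le_mul_of_nonneg_right h1 (abs_nonneg ω.im)
    have h6 := mul_le_mul_of_nonneg_left h4 hv
    nlinarith

end HalfPlane

section Positive

variable {μ : Measure ℝ} [IsProbabilityMeasure μ] {ω : ℂ}

/-- The point is `|ω| N ≤ 3 |g|`, which combines with `|g|² ≤ v N`. If `Re ω ≤ 0`, the terms `Re ω ·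
N` and `-p` of `Re g` have the same sign and cannot cancel; otherwise `|Im g| = |Im ω| N` is enough.
-/
lemma norm_hTransform_mul_norm_le_of_sector (hsupp : ∀ᵐ t ∂μ, 0 ≤ t)
    (hmom : MemLp (id : ℝ → ℝ) 2 μ) (hω : ω ∈ slitPlanePos)
    (h : ω.re ≤ 0 ∨ ‖ω‖ ≤ 3 * |ω.im|) :
    ‖hTransform μ ω - (∫ t, t ∂μ : ℝ)‖ * ‖ω‖ ≤ 3 * variance id μ := by
  obtain ⟨δ, hδ, hd⟩ := awayFrom_of_mem_slitPlanePos hsupp hω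
  obtain ⟨N, p, hN, h1, h2, hp⟩ := hTransform_sub_mean hδ hd
    (cauchyG_ne_zero_of_mem_slitPlanePos hsupp hω (integrable_of_memLp_two hmom)) hmom
  replace hp := hp hsupp
  have h3 := congrArg Complex.im h2
  have h3' := congrArg Complex.re h2
  rw [Complex.conj_im, Complex.sub_im (ω * N), Complex.im_mul_ofReal, Complex.ofReal_im, sub_zero] at h3
  rw [Complex.conj_re, Complex.sub_re (ω * N), Complex.re_mul_ofReal, Complex.ofReal_re] at h3'
  set g := hTransform μ ω - (∫ t, t ∂μ : ℝ)
  have h4 : ‖ω‖ * N ≤ 3 * ‖g‖ := by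
    rcases h with h | h
    · have : ‖ω‖ * N ≤ ‖g‖ := by
        refine le_of_sq_le_sq ?_ (norm_nonneg g)
        rw [mul_pow, ← Complex.normSq_eq_norm_sq, ← Complex.normSq_eq_norm_sq,
          Complex.normSq_apply, Complex.normSq_apply]
        have e1 : g.im = -(ω.im * N) := by linarith
        rw [e1, h3']
        have : ω.re * N ≤ 0 := mul_nonpos_of_nonpos_of_nonneg h hN
        nlinarith
      linarith [norm_nonneg g]
    · have : |ω.im| * N ≤ ‖g‖ := by
        rw [← abs_of_nonneg hN, ← abs_mul, ← h3, abs_neg]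
        exact Complex.abs_im_le_norm g
      nlinarith
  have hv := variance_nonneg id μ
  rcases (norm_nonneg g).eq_or_lt with h0 | h0
  · rw [← h0, zero_mul]; positivity
  · refine le_of_mul_le_mul_right ?_ h0
    have h5 := mul_le_mul_of_nonneg_right h1 (norm_nonneg ω)
    have h6 := mul_le_mul_of_nonneg_left h4 hv
    nlinarith

open Polynomial in
-- Nonzero variance excludes the default value of the quotients by `‖P₁‖²`, so that they can be
-- multiplied back.
lemma jacobi_moments (hm : ∫ t, t ∂μ = 1) (hv : variance id μ ≠ 0) :
    ∫ t, (t - 1) ^ 2 ∂μ = variance id μ ∧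
    ∫ t, t * (t - 1) ^ 2 ∂μ = jacobiBeta μ 1 * variance id μ ∧
    ∫ t, ((t - jacobiBeta μ 1) * (t - 1) - variance id μ) ^ 2 ∂μ =
      jacobiGamma μ 1 * variance id μ := by
  have h0 : ∫ t, (t - 1) ^ 2 ∂μ = variance id μ := by
    rw [variance_eq_integral aemeasurable_id]
    simp only [id, hm]
  have n0 : polyNormSq μ 1 = 1 := by simp [polyNormSq]
  have b0 : polyBeta μ 1 = 1 := by simp [polyBeta, n0, hm]
  have P1 : orthoPoly μ 1 = X - C 1 := by rw [orthoPoly, b0]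
  have n1 : polyNormSq μ (orthoPoly μ 1) = variance id μ := by
    rw [P1, ← h0, polyNormSq]; simp
  have P2 : orthoPoly μ 2 =
      (X - C (jacobiBeta μ 1)) * (X - C 1) - C (variance id μ) := by
    rw [orthoPoly, n1, orthoPoly, n0, P1, jacobiBeta, P1]; simp
  refine ⟨h0, ?_, ?_⟩
  · have : jacobiBeta μ 1 * polyNormSq μ (orthoPoly μ 1) =
        ∫ t, t * ((orthoPoly μ 1).eval t) ^ 2 ∂μ := by
      rw [jacobiBeta, polyBeta, div_mul_cancel₀]
      rwa [n1]
    rw [n1, P1] at this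
    rw [this]; simp
  · have : jacobiGamma μ 1 * polyNormSq μ (orthoPoly μ 1) = polyNormSq μ (orthoPoly μ 2) := by
      rw [jacobiGamma, div_mul_cancel₀]
      rwa [n1]
    rw [n1, P2] at this
    rw [this, polyNormSq]; simp

/-- With `g = h - 1` and `d = |Im ω|`, the second level gives `|g| (|ω| - R) - v ≤ γ |g| / d`. It
remains to absorb `R + γ / d` into `(2/3) |ω|`. -/
lemma norm_hTransform_mul_norm_le_of_jacobi (hsupp : ∀ᵐ t ∂μ, 0 ≤ t)
    (hmom : MemLp (id : ℝ → ℝ) 4 μ) (hm : ∫ t, t ∂μ = 1) {R : ℝ}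
    (hβ : jacobiBeta μ 1 ≤ R) (hγ : 2 * √(jacobiGamma μ 1) ≤ R) (hd : 0 < |ω.im|)
    (hdR : 7 / 10 * R ≤ |ω.im|) (hω : 3 * |ω.im| ≤ ‖ω‖) :
    ‖hTransform μ ω - 1‖ * ‖ω‖ ≤ 3 * variance id μ := by
  have hmom2 : MemLp (id : ℝ → ℝ) 2 μ := hmom.mono_exponent (by norm_num)
  have him : ω.im ≠ 0 := abs_pos.mp hd
  have hG := cauchyG_ne_zero_of_im_ne_zero him (integrable_of_memLp_two hmom2)
  rcases (variance_nonneg id μ).eq_or_lt with hv | hv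
  · have h := norm_hTransform_mul_im_le hmom2 him
    rw [hm, ← hv] at h
    have h0 : ‖hTransform μ ω - 1‖ = 0 := by
      have h1 : ‖hTransform μ ω - 1‖ * |ω.im| ≤ 0 := by simpa using h
      nlinarith [norm_nonneg (hTransform μ ω - 1)]
    rw [h0, ← hv]; simp
  · obtain ⟨δ, hδ, hdδ⟩ := awayFrom_of_im_ne_zero (μ := μ) him
    obtain ⟨m0, m1, m2⟩ := jacobi_moments hm hv.ne'
    have key := abs_im_mul_norm_hTransform_le hδ hdδ hG hmom hm hv m0 m1 m2
    have hβ0 : 0 ≤ jacobiBeta μ 1 := by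
      have : 0 ≤ jacobiBeta μ 1 * variance id μ := m1 ▸ integral_nonneg_of_ae (by
        filter_upwards [hsupp] with t ht
        positivity)
      exact nonneg_of_mul_nonneg_left this hv
    have hγ0 : 0 ≤ jacobiGamma μ 1 := by
      have : 0 ≤ jacobiGamma μ 1 * variance id μ := m2 ▸ integral_nonneg fun t => by positivity
      exact nonneg_of_mul_nonneg_left this hv
    generalize variance id μ = v at *
    generalize jacobiBeta μ 1 = β at *
    have hγR : 4 * jacobiGamma μ 1 ≤ R ^ 2 := by
      have h1 := Real.sq_sqrt hγ0
      have h2 := Real.sqrt_nonneg (jacobiGamma μ 1)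
      nlinarith
    generalize jacobiGamma μ 1 = γ at *
    rw [Complex.ofReal_one] at key
    set g := hTransform μ ω - 1
    have hR0 : 0 ≤ R := hβ0.trans hβ
    have h1 : ‖g‖ * (‖ω‖ - R) - v ≤ ‖g * (ω - β) - v‖ := by
      have h2 : ‖g * (ω - β)‖ - ‖(v : ℂ)‖ ≤ ‖g * (ω - β) - v‖ := norm_sub_norm_le _ _
      have h3 : ‖ω‖ - ‖(β : ℂ)‖ ≤ ‖ω - β‖ := norm_sub_norm_le _ _
      rw [Complex.norm_real, Real.norm_of_nonneg hβ0] at h3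
      rw [Complex.norm_real, Real.norm_of_nonneg hv.le, norm_mul] at h2
      have h4 : ‖g‖ * (‖ω‖ - R) ≤ ‖g‖ * ‖ω - β‖ := by gcongr; linarith
      linarith
    have h2 : |ω.im| * (‖g‖ * (‖ω‖ - R) - v) ≤ γ * ‖g‖ :=
      (mul_le_mul_of_nonneg_left h1 hd.le).trans key
    generalize |ω.im| = d at *
    -- As `|ω| ≥ 3d` and `γ ≤ R²/4`, it suffices that `R²/4 + dR ≤ 2d²`, that is `d ≥ R (1 + √3)/4`;
    -- the factor `7/10` is just above this threshold.
    have h3 : γ + d * R ≤ d * (2 / 3 * ‖ω‖) := by nlinarith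
    refine le_of_mul_le_mul_left ?_ hd
    nlinarith [norm_nonneg g, mul_le_mul_of_nonneg_right h3 (norm_nonneg g)]

end Positive

/-! ### Position of the product of `p = w²/z` and `q = h_{μ₃}(w)⁻¹` -/

section Geometry

variable {p q : ℂ} {s : ℝ}

/-- The hypothesis puts `q` in a disc in the closed upper half-plane meeting the real line only at
`1`. So `arg p ∈ (0, π)` and `arg q ∈ [0, π)`, and their sum lies in `(0, 2π)`. -/
lemma mul_mem_slitPlanePos (hp : 0 < p.im) (hs : 0 ≤ s)
    (h : ‖q - 1‖ ^ 2 ≤ s * q.im) : p * q ∈ slitPlanePos := by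
  rintro ⟨h1, h2⟩
  have hpp : 0 < p.re ^ 2 + p.im ^ 2 := by positivity
  rw [← Complex.normSq_eq_norm_sq, Complex.normSq_apply] at h
  simp only [Complex.sub_re, Complex.one_re, Complex.sub_im, Complex.one_im, sub_zero] at h
  rw [Complex.mul_im] at h1
  rw [Complex.mul_re] at h2
  have e : q.im * (p.re ^ 2 + p.im ^ 2) = -((p.re * q.re - p.im * q.im) * p.im) := by
    linear_combination p.re * h1
  have hqi : q.im ≤ 0 := by
    by_contra! hc
    have : 0 < q.im * (p.re ^ 2 + p.im ^ 2) := by positivity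
    have : 0 ≤ (p.re * q.re - p.im * q.im) * p.im := by positivity
    linarith
  have hsq : s * q.im ≤ 0 := mul_nonpos_of_nonneg_of_nonpos hs hqi
  have hq0 : q.im = 0 := by nlinarith [mul_self_nonneg (q.re - 1), mul_self_nonneg q.im]
  have hr : q.re = 1 := by nlinarith [mul_self_nonneg (q.re - 1), mul_self_nonneg q.im]
  rw [hq0, hr] at h1
  linarith

/-- Taking imaginary parts in `p |q|² = (pq) q̄`, with `Re (pq) > 0` and `Im q ≥ 0`, gives `Im p ·
|q| ≤ |Im (pq)|`. The disc containing `q` stays away from `0`. -/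
lemma le_abs_im_mul {y R : ℝ} (hy : 0 < y) (hR : 0 ≤ R) (hs : 0 ≤ s)
    (hRy : (5 / 2 + 6 * s) * R ≤ y) (hp : 14 / 25 * y ≤ p.im) (hq : q ≠ 0)
    (h : ‖q - 1‖ ^ 2 ≤ s * q.im) (hre : 0 < (p * q).re) :
    0 < |(p * q).im| ∧ 7 / 10 * R ≤ |(p * q).im| := by
  have hq0 : 0 < ‖q‖ := norm_pos_iff.mpr hq
  have hnq : ‖q‖ ^ 2 = q.re * q.re + q.im * q.im := by
    rw [← Complex.normSq_eq_norm_sq, Complex.normSq_apply]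
  rw [← Complex.normSq_eq_norm_sq, Complex.normSq_apply] at h
  simp only [Complex.sub_re, Complex.one_re, Complex.sub_im, Complex.one_im, sub_zero] at h
  have hqi : 0 ≤ q.im := by
    by_contra! hc
    nlinarith [mul_self_nonneg (q.re - 1), mul_pos_of_neg_of_neg hc hc,
      mul_nonneg hs (neg_nonneg.mpr hc.le)]
  have e : p.im * ‖q‖ ^ 2 + (p * q).re * q.im = (p * q).im * q.re := by
    rw [hnq, Complex.mul_re, Complex.mul_im]; ring
  have hre1 : |q.re| ≤ ‖q‖ := Complex.abs_re_le_norm q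
  have him1 : q.im ≤ ‖q‖ := (le_abs_self _).trans (Complex.abs_im_le_norm q)
  have h1 : p.im * ‖q‖ ≤ |(p * q).im| := by
    refine le_of_mul_le_mul_right ?_ hq0
    calc p.im * ‖q‖ * ‖q‖ = p.im * ‖q‖ ^ 2 := by ring
      _ ≤ (p * q).im * q.re := by nlinarith
      _ ≤ |(p * q).im| * |q.re| := by rw [← abs_mul]; exact le_abs_self _
      _ ≤ _ := by gcongr
  -- Expanding `|q - 1|² ≤ s Im q` gives `1 ≤ 2 Re q + s Im q`.
  have h2 : 1 ≤ (2 + s) * ‖q‖ := by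
    have := le_abs_self q.re
    nlinarith
  have h3 : 14 / 25 * y * ‖q‖ ≤ |(p * q).im| := (by gcongr : _ ≤ p.im * ‖q‖).trans h1
  refine ⟨lt_of_lt_of_le (by positivity) h3, le_trans ?_ h3⟩
  have h4 : 5 / 4 * (2 + s) * R ≤ y := by nlinarith
  have h5 : 5 / 4 * R ≤ y * ‖q‖ := by
    calc 5 / 4 * R = 5 / 4 * R * 1 := by ring
      _ ≤ 5 / 4 * R * ((2 + s) * ‖q‖) := by gcongr
      _ = 5 / 4 * (2 + s) * R * ‖q‖ := by ring
      _ ≤ _ := by gcongr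
  linarith

end Geometry

/-! ### What the two terms of `K` provide -/

/-- The image of the disc `D(z, y/5)`, `y = Im z`, under `T_z` lies in the concentric disc whose
radius is smaller by this factor. -/
noncomputable def selfMapRatio (v₁ v₃ y : ℝ) : ℝ := 375 / 16 * (1 + 5 * v₃ / (4 * y)) * v₁ / y

section Constants

variable {v₁ v₃ R y : ℝ}

lemma boundK_nonneg (hv₁ : 0 ≤ v₁) : 0 ≤ boundK v₁ v₃ R :=
  le_max_of_le_left (by positivity)

lemma boundK_pos (hv₁ : 0 < v₁) : 0 < boundK v₁ v₃ R :=
  lt_max_of_lt_left (by positivity)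

lemma boundK_mono (hv₃ : 0 ≤ v₃) {R' : ℝ} (hR : 0 ≤ R) (h : R ≤ R') :
    boundK v₁ v₃ R ≤ boundK v₁ v₃ R' := by
  unfold boundK
  gcongr

lemma selfMapRatio_nonneg (hv₁ : 0 ≤ v₁) (hv₃ : 0 ≤ v₃) (hy : 0 < y) :
    0 ≤ selfMapRatio v₁ v₃ y := by
  unfold selfMapRatio; positivity

lemma selfMapRatio_lt_one (hv₁ : 0 ≤ v₁) (hv₃ : 0 ≤ v₃) (h : boundK v₁ v₃ R < y) :
    selfMapRatio v₁ v₃ y < 1 := by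
  have hy : 0 < y := (boundK_nonneg hv₁).trans_lt h
  have h1 : 6 * (2 * v₁ + √(5 * v₁ ^ 2 + 2 * v₃ * v₁)) < y := (le_max_left _ _).trans_lt h
  have hrad : 0 ≤ 5 * v₁ ^ 2 + 2 * v₃ * v₁ := by positivity
  have h2 := Real.sq_sqrt hrad
  have h3 := Real.sqrt_nonneg (5 * v₁ ^ 2 + 2 * v₃ * v₁)
  -- The first term of `K` solves this quadratic inequality. Its coefficients `24` and `72` dominate
  -- the `375/16` and `1875/64` needed for a ratio below one.
  have h4 : 24 * v₁ * y + 36 * v₁ ^ 2 + 72 * v₃ * v₁ < y ^ 2 := by nlinarith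
  have e : selfMapRatio v₁ v₃ y = (375 / 16 * v₁ * y + 1875 / 64 * v₃ * v₁) / y ^ 2 := by
    unfold selfMapRatio; field_simp; ring
  rw [e, div_lt_one (by positivity)]
  nlinarith [mul_nonneg hv₁ hy.le, mul_nonneg hv₃ hv₁]

lemma mul_le_of_boundK_lt (hv₁ : 0 ≤ v₁) (hv₃ : 0 ≤ v₃) (hR : 0 ≤ R) (h : boundK v₁ v₃ R < y) :
    (5 / 2 + 6 * (5 * v₃ / (4 * y))) * R ≤ y := by
  have hy : 0 < y := (boundK_nonneg hv₁).trans_lt h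
  have h1 : R + 3 / 2 * √(R ^ 2 + 4 * R * v₃) < y := (le_max_right _ _).trans_lt h
  have hrad : 0 ≤ R ^ 2 + 4 * R * v₃ := by positivity
  have h2 := Real.sq_sqrt hrad
  have h3 := Real.sqrt_nonneg (R ^ 2 + 4 * R * v₃)
  have h4 : 9 / 4 * (R ^ 2 + 4 * R * v₃) ≤ (y - R) ^ 2 := by nlinarith
  set s := 5 * v₃ / (4 * y) with hs
  have hs0 : 0 ≤ s := by positivity
  -- Since `s` itself depends on `y`, the claim is not explicit in `y`. Trading `v₃` for `s` turns
  -- `h4` into `y (y - 2R - (36/5) s R) ≥ (5/4) R²`, which `y < (5/2 + 6s) R` contradicts.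
  have hv : v₃ = 4 / 5 * s * y := by rw [hs]; field_simp
  rw [hv] at h4
  by_contra! hc
  have h5 : y * (y - 2 * R - 36 / 5 * s * R) < 5 / 4 * R ^ 2 ∨ R = 0 := by
    rcases hR.eq_or_lt with h0 | h0
    · exact Or.inr h0.symm
    · left
      rcases le_or_gt (y - 2 * R - 36 / 5 * s * R) 0 with h6 | h6
      · have : y * (y - 2 * R - 36 / 5 * s * R) ≤ 0 :=
          mul_nonpos_of_nonneg_of_nonpos hy.le h6
        have : 0 < R ^ 2 := by positivity
        linarith
      · calc y * (y - 2 * R - 36 / 5 * s * R)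
            < ((5 / 2 + 6 * s) * R) * (y - 2 * R - 36 / 5 * s * R) := by gcongr
          _ ≤ ((5 / 2 + 6 * s) * R) * (R * (1 / 2 - 6 / 5 * s)) := by
              gcongr; linarith
          -- The linear terms cancel: `(5/2 + 6s)(1/2 - (6/5)s) = 5/4 - (36/5) s²`.
          _ ≤ _ := by nlinarith [sq_nonneg (s * R)]
  rcases h5 with h5 | h5
  · nlinarith
  · rw [h5] at hc; linarith

end Constants

/-! ### Estimates on the disc `D(z, Im z / 5)` -/

section Disc

variable {z w : ℂ}

lemma four_fifths_im_lt (hw : w ∈ ball z (z.im / 5)) : 4 / 5 * z.im < w.im := by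
  have h := (Complex.abs_im_le_norm (w - z)).trans_lt (mem_ball_iff_norm.mp hw)
  rw [Complex.sub_im, abs_lt] at h
  linarith

/-- The correction in `w²/z = z + 2(w - z) + (w - z)²/z` is at most `(2/5 + 1/25) Im z`, which
leaves `14/25`. -/
lemma im_sq_div_ge (hz : 0 < z.im) (hw : w ∈ ball z (z.im / 5)) :
    14 / 25 * z.im ≤ (w ^ 2 / z).im := by
  have hz0 : z ≠ 0 := fun h => by simp [h] at hz
  have hzn : z.im ≤ ‖z‖ := (le_abs_self _).trans (Complex.abs_im_le_norm z)
  have hδ : ‖w - z‖ < z.im / 5 := mem_ball_iff_norm.mp hw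
  have e : w ^ 2 / z = z + (2 * (w - z) + (w - z) ^ 2 / z) := by field_simp; ring
  have h1 : ‖2 * (w - z) + (w - z) ^ 2 / z‖ ≤ 11 / 25 * z.im := by
    refine (norm_add_le _ _).trans ?_
    rw [norm_mul, norm_div, norm_pow, Complex.norm_ofNat]
    have h2 : ‖w - z‖ ^ 2 / ‖z‖ ≤ z.im / 25 := by
      rw [div_le_iff₀ (hz.trans_le hzn)]
      nlinarith [norm_nonneg (w - z)]
    linarith
  have h3 := (abs_le.mp ((Complex.abs_im_le_norm _).trans h1)).1
  rw [e, Complex.add_im]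
  linarith

lemma norm_le_of_mem_ball (hw : w ∈ ball z (z.im / 5)) :
    ‖z‖ ≤ 5 / 4 * ‖w‖ := by
  have hzn : z.im ≤ ‖z‖ := (le_abs_self _).trans (Complex.abs_im_le_norm z)
  have hδ : ‖w - z‖ < z.im / 5 := mem_ball_iff_norm.mp hw
  have : ‖z‖ - ‖w‖ ≤ ‖w - z‖ := by rw [norm_sub_rev]; exact norm_sub_norm_le z w
  linarith

variable {μ : Measure ℝ}

lemma inv_hTilde_mul_inv (hz : z ≠ 0) (hw : w ≠ 0) (h : hTransform μ w ≠ 0) :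
    (hTilde μ w)⁻¹ * z⁻¹ = w ^ 2 / z * (hTransform μ w)⁻¹ := by
  have : hTilde μ w = (w ^ 2)⁻¹ * hTransform μ w := rfl
  rw [this]; field_simp

variable [IsProbabilityMeasure μ]

lemma sq_norm_hTransform_sub_one_le (hmom : MemLp (id : ℝ → ℝ) 2 μ) (hm : ∫ t, t ∂μ = 1)
    (hz : 0 < z.im) (hw : w ∈ ball z (z.im / 5)) :
    ‖hTransform μ w - 1‖ ^ 2 ≤ 5 * variance id μ / (4 * z.im) * -(hTransform μ w).im := by
  have hwim := four_fifths_im_lt hw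
  have h := sq_norm_hTransform_mul_im_le hmom (ω := w) (by linarith)
  rw [hm, Complex.ofReal_one, Complex.sub_im, Complex.one_im, sub_zero] at h
  have e : 5 * variance id μ / (4 * z.im) * -(hTransform μ w).im =
      variance id μ * -(hTransform μ w).im / (4 / 5 * z.im) := by field_simp
  rw [e, le_div_iff₀ (by positivity)]
  exact (by gcongr : _ ≤ ‖hTransform μ w - 1‖ ^ 2 * w.im).trans h

lemma hTransform_ne_zero_of_mem_ball (hmom : MemLp (id : ℝ → ℝ) 2 μ) (hm : ∫ t, t ∂μ = 1)
    (hz : 0 < z.im) (hw : w ∈ ball z (z.im / 5)) : hTransform μ w ≠ 0 := by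
  intro h
  have := sq_norm_hTransform_sub_one_le hmom hm hz hw
  rw [h] at this
  norm_num at this

lemma norm_hTransform_le_of_mem_ball (hmom : MemLp (id : ℝ → ℝ) 2 μ) (hm : ∫ t, t ∂μ = 1)
    (hz : 0 < z.im) (hw : w ∈ ball z (z.im / 5)) :
    ‖hTransform μ w‖ ≤ 1 + 5 * variance id μ / (4 * z.im) := by
  have hwim := four_fifths_im_lt hw
  have h := norm_hTransform_mul_im_le hmom (ω := w) (by linarith)
  rw [hm, Complex.ofReal_one, abs_of_pos (by linarith)] at h
  have h1 : ‖hTransform μ w - 1‖ ≤ 5 * variance id μ / (4 * z.im) := by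
    have e : 5 * variance id μ / (4 * z.im) = variance id μ / (4 / 5 * z.im) := by field_simp
    rw [e, le_div_iff₀ (by positivity)]
    exact (by gcongr : _ ≤ ‖hTransform μ w - 1‖ * w.im).trans h
  have h2 : ‖hTransform μ w‖ ≤ ‖(1 : ℂ)‖ + ‖hTransform μ w - 1‖ := by
    simpa using norm_add_le 1 (hTransform μ w - 1)
  rw [norm_one] at h2
  linarith

/-- Inversion reflects the tangent disc at `1` into the upper half-plane with the same constant:
both `|h - 1|²` and `-Im h` are divided by `|h|²`. -/
lemma sq_norm_inv_hTransform_sub_one_le (hmom : MemLp (id : ℝ → ℝ) 2 μ) (hm : ∫ t, t ∂μ = 1)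
    (hz : 0 < z.im) (hw : w ∈ ball z (z.im / 5)) :
    ‖(hTransform μ w)⁻¹ - 1‖ ^ 2 ≤
      5 * variance id μ / (4 * z.im) * ((hTransform μ w)⁻¹).im := by
  have h0 := hTransform_ne_zero_of_mem_ball hmom hm hz hw
  have h := sq_norm_hTransform_sub_one_le hmom hm hz hw
  have hn : 0 < ‖hTransform μ w‖ ^ 2 := by positivity
  have e : (hTransform μ w)⁻¹ - 1 = -((hTransform μ w - 1) / hTransform μ w) := by
    field_simp; ring
  rw [e, norm_neg, norm_div, div_pow, Complex.inv_im, Complex.normSq_eq_norm_sq, ← mul_div_assoc]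
  gcongr

end Disc

/-! ### `T_z` shrinks the disc -/

section SelfMap

variable {μ₁ μ₃ : Measure ℝ} [IsProbabilityMeasure μ₁] [IsProbabilityMeasure μ₃]

lemma ne_zero_of_im_pos {z : ℂ} (hz : 0 < z.im) : z ≠ 0 := fun h => by simp [h] at hz

lemma hTilde_ne_zero_of_mem_ball (hmom₃ : MemLp (id : ℝ → ℝ) 2 μ₃) (hmean₃ : ∫ t, t ∂μ₃ = 1)
    {z w : ℂ} (hz : 0 < z.im) (hw : w ∈ ball z (z.im / 5)) : hTilde μ₃ w ≠ 0 := by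
  have hw0 : w ≠ 0 := ne_zero_of_im_pos (by linarith [four_fifths_im_lt hw])
  exact mul_ne_zero (inv_ne_zero (pow_ne_zero 2 hw0))
    (hTransform_ne_zero_of_mem_ball hmom₃ hmean₃ hz hw)

lemma subordination_mem_slitPlanePos (hmom₃ : MemLp (id : ℝ → ℝ) 2 μ₃)
    (hmean₃ : ∫ t, t ∂μ₃ = 1) {z w : ℂ} (hz : 0 < z.im) (hw : w ∈ ball z (z.im / 5)) :
    (hTilde μ₃ w)⁻¹ * z⁻¹ ∈ slitPlanePos := by
  have hw0 : w ≠ 0 := ne_zero_of_im_pos (by linarith [four_fifths_im_lt hw])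
  rw [inv_hTilde_mul_inv (ne_zero_of_im_pos hz) hw0
    (hTransform_ne_zero_of_mem_ball hmom₃ hmean₃ hz hw)]
  have hv := variance_nonneg id μ₃
  exact mul_mem_slitPlanePos (by linarith [im_sq_div_ge hz hw]) (by positivity)
    (sq_norm_inv_hTransform_sub_one_le hmom₃ hmean₃ hz hw)

/-- `|T_z(w) - z| = |z| |h_{μ₁}(ω) - 1|`, where `|z|` is at most a constant times `|ω|` and `|ω|
|h_{μ₁}(ω) - 1| ≤ 3σ₁²`. -/
lemma norm_iterT_sub_le (hsupp : ∀ᵐ t ∂μ₁, 0 ≤ t) (hmom₁ : MemLp (id : ℝ → ℝ) 4 μ₁)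
    (hmom₃ : MemLp (id : ℝ → ℝ) 2 μ₃) (hmean₁ : ∫ t, t ∂μ₁ = 1) (hmean₃ : ∫ t, t ∂μ₃ = 1)
    {R : ℝ} (hβ : jacobiBeta μ₁ 1 ≤ R) (hγ : 2 * √(jacobiGamma μ₁ 1) ≤ R) {z w : ℂ}
    (hz : boundK (variance id μ₁) (variance id μ₃) R < z.im) (hw : w ∈ ball z (z.im / 5)) :
    ‖iterT μ₁ μ₃ z w - z‖ ≤
      selfMapRatio (variance id μ₁) (variance id μ₃) z.im * (z.im / 5) := by
  have hv₁ := variance_nonneg id μ₁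
  have hv₃ := variance_nonneg id μ₃
  have hzim : 0 < z.im := (boundK_nonneg hv₁).trans_lt hz
  have hR : 0 ≤ R := le_trans (by positivity) hγ
  have hz0 := ne_zero_of_im_pos hzim
  have hw0 : w ≠ 0 := ne_zero_of_im_pos (by linarith [four_fifths_im_lt hw])
  have h30 := hTransform_ne_zero_of_mem_ball hmom₃ hmean₃ hzim hw
  have hRy := mul_le_of_boundK_lt hv₁ hv₃ hR hz
  have hslit := subordination_mem_slitPlanePos hmom₃ hmean₃ hzim hw
  have hmom₁' : MemLp (id : ℝ → ℝ) 2 μ₁ := hmom₁.mono_exponent (by norm_num)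
  have hs : 0 ≤ 5 * variance id μ₃ / (4 * z.im) := by positivity
  have hω := inv_hTilde_mul_inv hz0 hw0 h30
  have key : ‖hTransform μ₁ ((hTilde μ₃ w)⁻¹ * z⁻¹) - 1‖ * ‖(hTilde μ₃ w)⁻¹ * z⁻¹‖ ≤
      3 * variance id μ₁ := by
    -- Outside the narrow sector around the positive axis, positivity of the support is enough.
    -- Inside it `Re ω > 0`, so `le_abs_im_mul` applies and the Jacobi bound takes over.
    by_cases hsec : ((hTilde μ₃ w)⁻¹ * z⁻¹).re ≤ 0 ∨
        ‖(hTilde μ₃ w)⁻¹ * z⁻¹‖ ≤ 3 * |((hTilde μ₃ w)⁻¹ * z⁻¹).im|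
    · have := norm_hTransform_mul_norm_le_of_sector hsupp hmom₁' hslit hsec
      rwa [hmean₁, Complex.ofReal_one] at this
    · push Not at hsec
      have h1 := hsec.1
      rw [hω] at h1
      have h2 := le_abs_im_mul hzim hR hs hRy (im_sq_div_ge hzim hw) (inv_ne_zero h30)
        (sq_norm_inv_hTransform_sub_one_le hmom₃ hmean₃ hzim hw) h1
      rw [← hω] at h2
      exact norm_hTransform_mul_norm_le_of_jacobi hsupp hmom₁ hmean₁ hβ hγ h2.1 h2.2 hsec.2.le
  have hzω : ‖z‖ ≤ 25 / 16 * (1 + 5 * variance id μ₃ / (4 * z.im)) *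
      ‖(hTilde μ₃ w)⁻¹ * z⁻¹‖ := by
    have hzn : 0 < ‖z‖ := norm_pos_iff.mpr hz0
    have hhn : 0 < ‖hTransform μ₃ w‖ := norm_pos_iff.mpr h30
    have h1 := norm_le_of_mem_ball hw
    have h2 := norm_hTransform_le_of_mem_ball hmom₃ hmean₃ hzim hw
    rw [hω, norm_mul, norm_div, norm_inv, norm_pow, ← div_eq_mul_inv, div_div, ← mul_div_assoc,
      le_div_iff₀ (by positivity)]
    calc ‖z‖ * (‖z‖ * ‖hTransform μ₃ w‖) = ‖z‖ ^ 2 * ‖hTransform μ₃ w‖ := by ring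
      _ ≤ (5 / 4 * ‖w‖) ^ 2 * (1 + 5 * variance id μ₃ / (4 * z.im)) := by gcongr
      _ = _ := by ring
  have e : iterT μ₁ μ₃ z w - z = z * (hTransform μ₁ ((hTilde μ₃ w)⁻¹ * z⁻¹) - 1) := by
    rw [iterT]; ring
  rw [e, norm_mul]
  set ω := (hTilde μ₃ w)⁻¹ * z⁻¹
  calc ‖z‖ * ‖hTransform μ₁ ω - 1‖
      ≤ (25 / 16 * (1 + 5 * variance id μ₃ / (4 * z.im)) * ‖ω‖) * ‖hTransform μ₁ ω - 1‖ := by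
        gcongr
    _ = 25 / 16 * (1 + 5 * variance id μ₃ / (4 * z.im)) * (‖hTransform μ₁ ω - 1‖ * ‖ω‖) := by
        ring
    _ ≤ 25 / 16 * (1 + 5 * variance id μ₃ / (4 * z.im)) * (3 * variance id μ₁) := by gcongr
    _ = _ := by rw [selfMapRatio]; field_simp; ring

/-- Joint holomorphy of `(z, w) ↦ T_z(w)`. -/
lemma differentiableAt_iterT_comp (hsupp : ∀ᵐ t ∂μ₁, 0 ≤ t) (hmom₁ : MemLp (id : ℝ → ℝ) 2 μ₁)
    (hmom₃ : MemLp (id : ℝ → ℝ) 2 μ₃) (hmean₃ : ∫ t, t ∂μ₃ = 1) {f g : ℂ → ℂ} {u : ℂ}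
    (hf : DifferentiableAt ℂ f u) (hg : DifferentiableAt ℂ g u) (hz : 0 < (f u).im)
    (hw : g u ∈ ball (f u) ((f u).im / 5)) :
    DifferentiableAt ℂ (fun x => iterT μ₁ μ₃ (f x) (g x)) u := by
  have hwim : (g u).im ≠ 0 := by linarith [four_fifths_im_lt hw]
  have hslit := subordination_mem_slitPlanePos hmom₃ hmean₃ hz hw
  have d3 : DifferentiableAt ℂ (hTransform μ₃) (g u) :=
    differentiableAt_hTransform (awayFrom_of_im_ne_zero hwim)
      (cauchyG_ne_zero_of_im_ne_zero hwim (integrable_of_memLp_two hmom₃))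
  have d1 : DifferentiableAt ℂ (hTransform μ₁) ((hTilde μ₃ (g u))⁻¹ * (f u)⁻¹) :=
    differentiableAt_hTransform (awayFrom_of_mem_slitPlanePos hsupp hslit)
      (cauchyG_ne_zero_of_mem_slitPlanePos hsupp hslit (integrable_of_memLp_two hmom₁))
  have hg0 : g u ≠ 0 := fun h => hwim (by simp [h])
  have dT : DifferentiableAt ℂ (fun x => hTilde μ₃ (g x)) u := by
    have d3' : DifferentiableAt ℂ (fun x => hTransform μ₃ (g x)) u := d3.comp u hg
    exact ((hg.pow 2).inv (pow_ne_zero 2 hg0)).mul d3'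
  have dω : DifferentiableAt ℂ (fun x => (hTilde μ₃ (g x))⁻¹ * (f x)⁻¹) u :=
    (dT.inv (hTilde_ne_zero_of_mem_ball hmom₃ hmean₃ hz hw)).mul (hf.inv (ne_zero_of_im_pos hz))
  have d1' : DifferentiableAt ℂ (fun x => hTransform μ₁ ((hTilde μ₃ (g x))⁻¹ * (f x)⁻¹)) u :=
    DifferentiableAt.comp (g := hTransform μ₁) u d1 dω
  exact hf.mul d1'

end SelfMap

/-! ### The fixed point and its dependence on `z` -/

section FixedPoint

variable {μ₁ μ₃ : Measure ℝ} [IsProbabilityMeasure μ₁] [IsProbabilityMeasure μ₃]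

lemma exists_fixedPoint_iterT (hsupp : ∀ᵐ t ∂μ₁, 0 ≤ t) (hmom₁ : MemLp (id : ℝ → ℝ) 4 μ₁)
    (hmom₃ : MemLp (id : ℝ → ℝ) 2 μ₃) (hmean₁ : ∫ t, t ∂μ₁ = 1) (hmean₃ : ∫ t, t ∂μ₃ = 1)
    {R : ℝ} (hβ : jacobiBeta μ₁ 1 ≤ R) (hγ : 2 * √(jacobiGamma μ₁ 1) ≤ R) {z : ℂ}
    (hz : boundK (variance id μ₁) (variance id μ₃) R < z.im) :
    ∃ x ∈ ball z (z.im / 5), iterT μ₁ μ₃ z x = x ∧ ∀ a ∈ ball z (z.im / 5), ∀ n : ℕ,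
      ‖(iterT μ₁ μ₃ z)^[n] a - x‖ ≤ z.im / 5 *
        (2 * contractionConst (selfMapRatio (variance id μ₁) (variance id μ₃) z.im) ^ n) := by
  have hv₁ := variance_nonneg id μ₁
  have hv₃ := variance_nonneg id μ₃
  have hzim : 0 < z.im := (boundK_nonneg hv₁).trans_lt hz
  refine exists_fixedPoint_ball (by positivity) (selfMapRatio_nonneg hv₁ hv₃ hzim)
    (selfMapRatio_lt_one hv₁ hv₃ hz) (fun w hw => ?_)
    (fun w hw => norm_iterT_sub_le hsupp hmom₁ hmom₃ hmean₁ hmean₃ hβ hγ hz hw)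
  exact (differentiableAt_iterT_comp hsupp (hmom₁.mono_exponent (by norm_num)) hmom₃ hmean₃
    (f := fun _ => z) (g := fun x => x) (differentiableAt_const z) differentiableAt_fun_id hzim
    hw).differentiableWithinAt

lemma mapsTo_iterT (hsupp : ∀ᵐ t ∂μ₁, 0 ≤ t) (hmom₁ : MemLp (id : ℝ → ℝ) 4 μ₁)
    (hmom₃ : MemLp (id : ℝ → ℝ) 2 μ₃) (hmean₁ : ∫ t, t ∂μ₁ = 1) (hmean₃ : ∫ t, t ∂μ₃ = 1)
    {R : ℝ} (hβ : jacobiBeta μ₁ 1 ≤ R) (hγ : 2 * √(jacobiGamma μ₁ 1) ≤ R) {z : ℂ}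
    (hz : boundK (variance id μ₁) (variance id μ₃) R < z.im) :
    Set.MapsTo (iterT μ₁ μ₃ z) (ball z (z.im / 5)) (ball z (z.im / 5)) := fun w hw => by
  have hv₁ := variance_nonneg id μ₁
  have hzim : 0 < z.im := (boundK_nonneg hv₁).trans_lt hz
  rw [mem_ball_iff_norm]
  refine (norm_iterT_sub_le hsupp hmom₁ hmom₃ hmean₁ hmean₃ hβ hγ hz hw).trans_lt ?_
  have := selfMapRatio_lt_one hv₁ (variance_nonneg id μ₃) hz
  nlinarith

lemma isOpen_upperPlane (K : ℝ) : IsOpen (upperPlane K) :=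
  isOpen_lt continuous_const Complex.continuous_im

lemma continuousAt_contractionConst_selfMapRatio {v₁ v₃ y : ℝ} (hy : 0 < y) :
    ContinuousAt (fun y => contractionConst (selfMapRatio v₁ v₃ y)) y := by
  have h : y ≠ 0 := hy.ne'
  have h4 : 4 * y ≠ 0 := by positivity
  have h1 : ContinuousAt (fun y => selfMapRatio v₁ v₃ y) y := by
    unfold selfMapRatio
    fun_prop (disch := assumption)
  unfold contractionConst
  fun_prop

/-- The iterates started at `w = z` are holomorphic in `z`, and the explicit geometric rate is
continuous in `Im z`, so they converge locally uniformly. -/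
lemma differentiableOn_fixedPoint (hsupp : ∀ᵐ t ∂μ₁, 0 ≤ t) (hmom₁ : MemLp (id : ℝ → ℝ) 4 μ₁)
    (hmom₃ : MemLp (id : ℝ → ℝ) 2 μ₃) (hmean₁ : ∫ t, t ∂μ₁ = 1) (hmean₃ : ∫ t, t ∂μ₃ = 1)
    {R K : ℝ} (hβ : jacobiBeta μ₁ 1 ≤ R) (hγ : 2 * √(jacobiGamma μ₁ 1) ≤ R)
    (hK : K = boundK (variance id μ₁) (variance id μ₃) R) {ω₃ : ℂ → ℂ}
    (hω : ∀ z ∈ upperPlane K, ∀ a ∈ ball z (z.im / 5), ∀ n : ℕ,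
      ‖(iterT μ₁ μ₃ z)^[n] a - ω₃ z‖ ≤ z.im / 5 *
        (2 * contractionConst (selfMapRatio (variance id μ₁) (variance id μ₃) z.im) ^ n)) :
    DifferentiableOn ℂ ω₃ (upperPlane K) := by
  have hv₁ := variance_nonneg id μ₁
  have hv₃ := variance_nonneg id μ₃
  have him : ∀ z ∈ upperPlane K, 0 < z.im := fun z hz =>
    (hK ▸ boundK_nonneg hv₁ : 0 ≤ K).trans_lt hz
  have hball : ∀ z ∈ upperPlane K, z ∈ ball z (z.im / 5) := fun z hz =>
    mem_ball_self (by linarith [him z hz])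
  have hlim : TendstoLocallyUniformlyOn (fun n z => (iterT μ₁ μ₃ z)^[n] z) ω₃ atTop
      (upperPlane K) := by
    rw [Metric.tendstoLocallyUniformlyOn_iff]
    intro ε hε z₀ hz₀
    have hz₀' := him z₀ hz₀
    obtain ⟨k, hk0, hk1⟩ := exists_between (contractionConst_lt_one
      (selfMapRatio_nonneg hv₁ hv₃ hz₀') (selfMapRatio_lt_one hv₁ hv₃ (hK ▸ hz₀)))
    have hcont : ContinuousAt (fun z : ℂ => contractionConst
        (selfMapRatio (variance id μ₁) (variance id μ₃) z.im)) z₀ :=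
      ContinuousAt.comp (g := fun y : ℝ => contractionConst
        (selfMapRatio (variance id μ₁) (variance id μ₃) y)) (f := Complex.im)
        (continuousAt_contractionConst_selfMapRatio hz₀') Complex.continuous_im.continuousAt
    have e1 := hcont.eventually_lt continuousAt_const hk0
    have e2 : ∀ᶠ z : ℂ in 𝓝 z₀, z.im < z₀.im + 1 :=
      Complex.continuous_im.continuousAt.eventually_lt continuousAt_const (by simp)
    have hk : 0 ≤ k := (contractionConst_nonneg _).trans hk0.le
    have e3 : ∀ᶠ n : ℕ in atTop, (z₀.im + 1) / 5 * (2 * k ^ n) < ε := by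
      have h := ((tendsto_pow_atTop_nhds_zero_of_lt_one hk hk1).const_mul 2).const_mul
        ((z₀.im + 1) / 5)
      rw [mul_zero, mul_zero] at h
      exact h.eventually_lt_const hε
    refine ⟨{z | z ∈ upperPlane K ∧ contractionConst
        (selfMapRatio (variance id μ₁) (variance id μ₃) z.im) < k ∧ z.im < z₀.im + 1}, ?_, ?_⟩
    · filter_upwards [self_mem_nhdsWithin, nhdsWithin_le_nhds e1, nhdsWithin_le_nhds e2]
        with z h1 h2 h3 using ⟨h1, h2, h3⟩
    · filter_upwards [e3] with n hn z ⟨h1, h2, h3⟩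
      rw [dist_comm, dist_eq_norm]
      refine (hω z h1 z (hball z h1) n).trans_lt (lt_of_le_of_lt ?_ hn)
      have hc := contractionConst_nonneg
        (selfMapRatio (variance id μ₁) (variance id μ₃) z.im)
      have := him z h1
      gcongr
  refine hlim.differentiableOn (Eventually.of_forall fun n => ?_) (isOpen_upperPlane K)
  induction n with
  | zero => exact differentiableOn_id
  | succ n ih =>
    simp only [Function.iterate_succ_apply']
    intro z hz
    refine (differentiableAt_iterT_comp hsupp (hmom₁.mono_exponent (by norm_num)) hmom₃ hmean₃
      (f := fun z => z) (g := fun z => (iterT μ₁ μ₃ z)^[n] z) differentiableAt_fun_id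
      (ih.differentiableAt ((isOpen_upperPlane K).mem_nhds hz)) (him z hz)
      ?_).differentiableWithinAt
    exact (mapsTo_iterT hsupp hmom₁ hmom₃ hmean₁ hmean₃ hβ hγ (hK ▸ hz)).iterate n (hball z hz)

end FixedPoint

/-! ### Identity theorem on an uncountable set -/

section Identity

/-- Otherwise `S` would be discrete, and a discrete Lindelöf space is countable. -/
lemma exists_frequently_nhdsNE_of_not_countable {S : Set ℂ} (hS : ¬ S.Countable) :
    ∃ x ∈ S, ∃ᶠ y in 𝓝[≠] x, y ∈ S := by
  by_contra! h
  refine hS ?_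
  have : DiscreteTopology S := by
    rw [discreteTopology_subtype_iff]
    intro x hx
    have := h x hx
    rw [← disjoint_iff, disjoint_principal_right]
    exact this
  have : Countable S := countable_of_Lindelof_of_discrete
  exact Set.to_countable S

/-- The identity theorem for an uncountable set of coincidence points. -/
lemma eqOn_of_not_countable {U S : Set ℂ} (hU : IsOpen U) (hc : IsPreconnected U) {f g : ℂ → ℂ}
    (hf : DifferentiableOn ℂ f U) (hg : DifferentiableOn ℂ g U) (hS : ¬ S.Countable) (hSU : S ⊆ U)
    (h : ∀ x ∈ S, f x = g x) : Set.EqOn f g U := by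
  obtain ⟨x, hx, hfr⟩ := exists_frequently_nhdsNE_of_not_countable hS
  exact (hf.analyticOnNhd hU).eqOn_of_preconnected_of_frequently_eq (hg.analyticOnNhd hU) hc
    (hSU hx) (hfr.mono h)

end Identity

/-! ### Inverses of `η_μ` along the imaginary axis -/

section Sigma

/-- The radial path `t ↦ -it`. -/
def radial (t : ℝ) : ℂ := -(Complex.I * t)

lemma radial_mem_stolz {α r t : ℝ} (hα : 0 < α) (ht : 0 < t) (htr : t < r) :
    radial t ∈ stolz α r := by
  refine ⟨?_, ?_⟩
  · simp only [radial, Complex.neg_re, Complex.I_mul_re, Complex.ofReal_im, neg_zero, abs_zero,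
      Complex.neg_im, Complex.I_mul_im, Complex.ofReal_re, abs_neg]
    positivity
  · simpa [radial, abs_of_pos ht] using htr

lemma tendsto_radial {α r : ℝ} (hα : 0 < α) (hr : 0 < r) :
    Tendsto radial (𝓝[>] 0) (𝓝[stolz α r] 0) := by
  refine tendsto_nhdsWithin_iff.mpr ⟨?_, ?_⟩
  · have : Continuous radial := by unfold radial; fun_prop
    have h := this.tendsto 0
    simp only [radial, Complex.ofReal_zero, mul_zero, neg_zero] at h
    exact h.mono_left nhdsWithin_le_nhds
  · filter_upwards [Ioo_mem_nhdsGT hr] with t ht using radial_mem_stolz hα ht.1 ht.2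

/-- `η_μ(χ(u)) = u` says `h_μ(1/χ(u)) = u/χ(u)`. The cone condition makes `1/χ(u)` go to infinity
non-tangentially, where `h_μ` tends to the mean at rate `v / |Im|`. -/
lemma IsEtaInverse.tendsto_radial {μ : Measure ℝ} [IsProbabilityMeasure μ]
    (hmom : MemLp (id : ℝ → ℝ) 2 μ) {α r : ℝ} (hα : 0 < α) (hr : 0 < r) {χ : ℂ → ℂ}
    (hχ : IsEtaInverse μ (stolz α r) χ) :
    (∀ u ∈ stolz α r, χ u ≠ 0 ∧ hTransform μ (χ u)⁻¹ = u * (χ u)⁻¹) ∧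
    Tendsto (fun t => radial t * (χ (radial t))⁻¹) (𝓝[>] 0) (𝓝 (∫ t, t ∂μ : ℝ)) := by
  obtain ⟨⟨b, hb, s, hs, hmaps⟩, hinv, hlim⟩ := hχ
  have him : ∀ u ∈ stolz α r, (χ u).im ≠ 0 := fun u hu h0 => by
    have := (hmaps hu).1
    rw [h0, abs_zero, mul_zero] at this
    exact absurd this (not_lt.mpr (abs_nonneg _))
  have hne : ∀ u ∈ stolz α r, χ u ≠ 0 := fun u hu h => him u hu (by simp [h])
  have heq : ∀ u ∈ stolz α r, hTransform μ (χ u)⁻¹ = u * (χ u)⁻¹ := fun u hu => by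
    have h : χ u * hTransform μ (χ u)⁻¹ = u := hinv u hu
    rw [← div_eq_mul_inv, eq_div_iff (hne u hu), mul_comm, h]
  refine ⟨fun u hu => ⟨hne u hu, heq u hu⟩, ?_⟩
  have hχ0 : Tendsto (fun t => χ (radial t)) (𝓝[>] 0) (𝓝 0) :=
    hlim.comp (FreeDeconv.tendsto_radial hα hr)
  have hbound : ∀ᶠ t in 𝓝[>] (0 : ℝ), ‖radial t * (χ (radial t))⁻¹ - (∫ t, t ∂μ : ℝ)‖ ≤
      variance id μ * (1 + b) * ‖χ (radial t)‖ := by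
    filter_upwards [Ioo_mem_nhdsGT hr] with t ht
    have hu := radial_mem_stolz hα ht.1 ht.2
    rw [← heq _ hu]
    have h1 := (hmaps hu).1
    have h0 := him _ hu
    have hn := norm_pos_iff.mpr (hne _ hu)
    generalize χ (radial t) = x at *
    have hxim : (x⁻¹).im ≠ 0 := by
      rw [Complex.inv_im]
      exact div_ne_zero (neg_ne_zero.mpr h0) (Complex.normSq_pos.mpr (norm_pos_iff.mp hn)).ne'
    have h2 := norm_hTransform_mul_im_le hmom hxim
    have h3 : |(x⁻¹).im| = |x.im| / ‖x‖ ^ 2 := by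
      rw [Complex.inv_im, abs_div, abs_neg, Complex.normSq_eq_norm_sq, abs_of_nonneg (sq_nonneg ‖x‖)]
    have h4 : ‖x‖ ≤ (1 + b) * |x.im| := by
      have := Complex.norm_le_abs_re_add_abs_im x
      linarith
    have h5 : 1 ≤ |(x⁻¹).im| * ((1 + b) * ‖x‖) := by
      rw [h3]
      have : |x.im| / ‖x‖ ^ 2 * ((1 + b) * ‖x‖) = (1 + b) * |x.im| / ‖x‖ := by field_simp
      rw [this, le_div_iff₀ hn]
      linarith
    calc ‖hTransform μ x⁻¹ - (∫ t, t ∂μ : ℝ)‖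
        ≤ ‖hTransform μ x⁻¹ - (∫ t, t ∂μ : ℝ)‖ * (|(x⁻¹).im| * ((1 + b) * ‖x‖)) :=
          le_mul_of_one_le_right (norm_nonneg _) h5
      _ = ‖hTransform μ x⁻¹ - (∫ t, t ∂μ : ℝ)‖ * |(x⁻¹).im| * ((1 + b) * ‖x‖) := by ring
      _ ≤ variance id μ * ((1 + b) * ‖x‖) := by gcongr
      _ = _ := by ring
  rw [tendsto_iff_norm_sub_tendsto_zero]
  refine squeeze_zero' (Eventually.of_forall fun t => norm_nonneg _) hbound ?_
  have := hχ0.norm.const_mul (variance id μ * (1 + b))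
  simpa using this

end Sigma

/-! ### Recovery of `μ₂` -/

section Recovery

variable {μ₁ μ₂ μ₃ : Measure ℝ} [IsProbabilityMeasure μ₁] [IsProbabilityMeasure μ₂]
  [IsProbabilityMeasure μ₃]

/-- Take `z = 1/χ₂(u)`, `w = 1/χ₃(u)`, `ω = 1/χ₁(u)` with `u = -it`; the sign makes `z ≈ i/t` lie in
the upper half-plane. The `Σ`-relation reads `w = u ω z`, and with `h_{μ₃}(w) = u w` and `h_{μ₁}(ω)
= u ω` this is `T_z(w) = w`. -/
lemma IsFreeMulConv.exists_subordination_points (hmom₁ : MemLp (id : ℝ → ℝ) 2 μ₁)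
    (hmom₂ : MemLp (id : ℝ → ℝ) 2 μ₂) (hmom₃ : MemLp (id : ℝ → ℝ) 2 μ₃)
    (hmean₁ : ∫ t, t ∂μ₁ = 1) (hmean₃ : ∫ t, t ∂μ₃ = 1) (h : IsFreeMulConv μ₁ μ₂ μ₃) (K : ℝ) :
    ∃ t₀ > 0, ∃ Z : ℝ → ℂ, ∀ t ∈ Set.Ioo 0 t₀, Z t ∈ upperPlane K ∧
      hTransform μ₂ (Z t) = radial t * Z t ∧
      ∃ w ∈ ball (Z t) ((Z t).im / 5), hTransform μ₃ w = radial t * w ∧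
        iterT μ₁ μ₃ (Z t) w = w := by
  obtain ⟨α, hα, r, hr, S₁, S₂, S₃, ⟨χ₁, hχ₁, hS₁⟩, ⟨χ₂, hχ₂, hS₂⟩, ⟨χ₃, hχ₃, hS₃⟩, hS⟩ := h
  obtain ⟨e₁, l₁⟩ := hχ₁.tendsto_radial hmom₁ hα hr
  obtain ⟨e₂, l₂⟩ := hχ₂.tendsto_radial hmom₂ hα hr
  obtain ⟨e₃, l₃⟩ := hχ₃.tendsto_radial hmom₃ hα hr
  rw [hmean₁, Complex.ofReal_one] at l₁
  rw [hmean₃, Complex.ofReal_one] at l₃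
  have hu0 : ∀ t : ℝ, 0 < t → radial t ≠ 0 := fun t ht => by simp [radial, ht.ne']
  have hprod : ∀ t ∈ Set.Ioo 0 r, (χ₃ (radial t))⁻¹ =
      radial t * (χ₁ (radial t))⁻¹ * (χ₂ (radial t))⁻¹ := fun t ht => by
    have hu := radial_mem_stolz hα ht.1 ht.2
    have h0 := hu0 t ht.1
    have := hS _ hu
    rw [hS₁ _ hu, hS₂ _ hu, hS₃ _ hu] at this
    have n1 := (e₁ _ hu).1
    have n2 := (e₂ _ hu).1
    have n3 := (e₃ _ hu).1
    generalize radial t = u at *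
    field_simp at this ⊢
    exact this
  -- The relation gives `u/χ₃ = (u/χ₁)(u/χ₂)`; in the limit the means multiply.
  have hm₂ : ((∫ t, t ∂μ₂ : ℝ) : ℂ) = 1 := by
    have h1 := l₁.mul l₂
    rw [one_mul] at h1
    refine tendsto_nhds_unique h1 (l₃.congr' ?_)
    filter_upwards [Ioo_mem_nhdsGT hr] with t ht
    rw [hprod t ht]
    ring
  rw [hm₂] at l₂
  -- With tolerance `1/20`, `t |w - z| < 1/10`, while `t Im z > 19/20` makes the scaled radius
  -- exceed `19/100`.
  have close : ∀ {f : ℝ → ℂ}, Tendsto f (𝓝[>] 0) (𝓝 1) → ∀ᶠ t in 𝓝[>] (0 : ℝ),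
      ‖f t - 1‖ < 1 / 20 := fun hf => by
    have := Metric.tendsto_nhds.mp hf (1 / 20) (by norm_num)
    simpa only [dist_eq_norm] using this
  have hKt : ∀ᶠ t in 𝓝[>] (0 : ℝ), K * t < 19 / 20 := by
    have : Tendsto (fun t : ℝ => K * t) (𝓝[>] 0) (𝓝 (K * 0)) :=
      ((continuous_const_mul K).tendsto 0).mono_left nhdsWithin_le_nhds
    exact this.eventually_lt_const (by norm_num)
  obtain ⟨t₀, ht₀, hsub⟩ := mem_nhdsGT_iff_exists_Ioo_subset.mp
    (((close l₂).and (close l₃)).and (hKt.and (Ioo_mem_nhdsGT hr)))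
  refine ⟨t₀, ht₀, fun t => (χ₂ (radial t))⁻¹, fun t ht => ?_⟩
  obtain ⟨⟨c₂, c₃⟩, hK, htr⟩ := hsub ht
  have hu := radial_mem_stolz hα ht.1 htr.2
  have h0 := hu0 t ht.1
  have hw := hprod t htr
  have E₁ := (e₁ _ hu).2
  have E₂ := (e₂ _ hu).2
  have E₃ := (e₃ _ hu).2
  have n₁ := inv_ne_zero (e₁ _ hu).1
  have n₂ := inv_ne_zero (e₂ _ hu).1
  have n₃ := inv_ne_zero (e₃ _ hu).1
  have him : ∀ x : ℂ, (radial t * x).re = t * x.im := fun x => by simp [radial]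
  have hnorm : ‖radial t‖ = t := by simp [radial, abs_of_pos ht.1]
  beta_reduce
  generalize (χ₁ (radial t))⁻¹ = ω at *
  generalize (χ₂ (radial t))⁻¹ = z at *
  generalize (χ₃ (radial t))⁻¹ = w at *
  have hz : 19 / 20 < t * z.im := by
    have h1 := (abs_lt.mp ((Complex.abs_re_le_norm _).trans_lt c₂)).1
    rw [Complex.sub_re, him, Complex.one_re] at h1
    linarith
  refine ⟨?_, E₂, w, ?_, E₃, ?_⟩
  · change K < z.im
    by_contra! hc
    have := mul_le_mul_of_nonneg_left hc ht.1.le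
    linarith
  · rw [mem_ball_iff_norm]
    refine lt_of_mul_lt_mul_left ?_ ht.1.le
    calc t * ‖w - z‖ = ‖(radial t * w - 1) - (radial t * z - 1)‖ := by
          rw [sub_sub_sub_cancel_right, ← mul_sub, norm_mul, hnorm]
      _ ≤ ‖radial t * w - 1‖ + ‖radial t * z - 1‖ := norm_sub_le _ _
      _ < t * (z.im / 5) := by linarith
  · have hT : hTilde μ₃ w = radial t / w := by
      have : hTilde μ₃ w = (w ^ 2)⁻¹ * hTransform μ₃ w := rfl
      rw [this, E₃]
      field_simp
    have hω : (radial t / w)⁻¹ * z⁻¹ = ω := by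
      rw [hw]
      field_simp
    rw [iterT, hT, hω, E₁, hw]
    ring

/-- At the points `Z t` both sides equal `(1 - u) z w`. No continuity of the inverses is assumed, so
these points need not form a curve; they are only known to be uncountably many. -/
lemma recipF_mul_fixedPoint (hmom₁ : MemLp (id : ℝ → ℝ) 2 μ₁)
    (hmom₂ : MemLp (id : ℝ → ℝ) 2 μ₂) (hmom₃ : MemLp (id : ℝ → ℝ) 2 μ₃)
    (hmean₁ : ∫ t, t ∂μ₁ = 1) (hmean₃ : ∫ t, t ∂μ₃ = 1) (h : IsFreeMulConv μ₁ μ₂ μ₃) {K : ℝ}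
    (hK : 0 ≤ K) {ω₃ : ℂ → ℂ} (hd : DifferentiableOn ℂ ω₃ (upperPlane K))
    (hball : ∀ z ∈ upperPlane K, ω₃ z ∈ ball z (z.im / 5))
    (huniq : ∀ z ∈ upperPlane K, ∀ w ∈ ball z (z.im / 5), iterT μ₁ μ₃ z w = w → w = ω₃ z) :
    ∀ z ∈ upperPlane K, recipF μ₂ z * ω₃ z = recipF μ₃ (ω₃ z) * z := by
  obtain ⟨t₀, ht₀, Z, hZ⟩ := h.exists_subordination_points hmom₁ hmom₂ hmom₃ hmean₁ hmean₃ K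
  have him : ∀ z ∈ upperPlane K, 0 < z.im := fun z hz => hK.trans_lt hz
  have him₃ : ∀ z ∈ upperPlane K, 0 < (ω₃ z).im := fun z hz => by
    linarith [four_fifths_im_lt (hball z hz), him z hz]
  have dF : ∀ {μ : Measure ℝ} [IsProbabilityMeasure μ], MemLp (id : ℝ → ℝ) 2 μ → ∀ {z : ℂ},
      0 < z.im → DifferentiableAt ℂ (recipF μ) z := fun hmom z hz =>
    differentiableAt_recipF (awayFrom_of_im_ne_zero hz.ne')
      (cauchyG_ne_zero_of_im_ne_zero hz.ne' (integrable_of_memLp_two hmom))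
  have hinj : Set.InjOn Z (Set.Ioo 0 t₀) := fun s hs t ht hst => by
    have h1 := (hZ s hs).2.1
    have h2 := (hZ t ht).2.1
    have hne : Z t ≠ 0 := ne_zero_of_im_pos (him _ (hZ t ht).1)
    rw [hst, h2] at h1
    have h3 := mul_right_cancel₀ hne h1
    simpa [radial] using h3.symm
  refine eqOn_of_not_countable (S := Z '' Set.Ioo 0 t₀) (isOpen_upperPlane K)
    (convex_halfSpace_im_gt K).isPreconnected ?_ ?_ ?_ ?_ ?_
  · exact DifferentiableOn.mul
      (fun z hz => (dF hmom₂ (him z hz)).differentiableWithinAt) hd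
  · refine DifferentiableOn.mul (fun z hz => ?_) differentiableOn_id
    exact DifferentiableWithinAt.comp (g := recipF μ₃) (t := Set.univ) z
      (dF hmom₃ (him₃ z hz)).differentiableWithinAt (hd z hz) (Set.mapsTo_univ _ _)
  · intro hc
    have hc' := Set.countable_of_injective_of_countable_image hinj hc
    rw [← Cardinal.le_aleph0_iff_set_countable, Cardinal.mk_Ioo_real ht₀] at hc'
    exact absurd Cardinal.aleph0_lt_continuum (not_lt.mpr hc')
  · rintro _ ⟨t, ht, rfl⟩
    exact (hZ t ht).1
  · rintro _ ⟨t, ht, rfl⟩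
    obtain ⟨h1, h2, w, hw, h3, h4⟩ := hZ t ht
    rw [← huniq _ h1 w hw h4]
    have e2 : recipF μ₂ (Z t) = Z t - hTransform μ₂ (Z t) := (sub_sub_cancel _ _).symm
    have e3 : recipF μ₃ w = w - hTransform μ₃ w := (sub_sub_cancel _ _).symm
    rw [e2, e3, h2, h3]
    ring

end Recovery

end FreeDeconv

/-! ### The theorem -/

theorem theorem1p4 (μ₁ μ₃ : Measure ℝ) [IsProbabilityMeasure μ₁] [IsProbabilityMeasure μ₃]
    (hsupp : ∀ᵐ t ∂μ₁, 0 ≤ t)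
    (hmom₁ : MemLp (id : ℝ → ℝ) 4 μ₁) (hmom₃ : MemLp (id : ℝ → ℝ) 2 μ₃)
    (hmean₁ : ∫ t, t ∂μ₁ = 1) (hmean₃ : ∫ t, t ∂μ₃ = 1)
    (v₁ v₃ β γ K : ℝ)
    (hv₁ : v₁ = variance id μ₁) (hv₃ : v₃ = variance id μ₃)
    (hβ : β = FreeDeconv.jacobiBeta μ₁ 1) (hγ : γ = FreeDeconv.jacobiGamma μ₁ 1)
    (hK : K = FreeDeconv.constK v₁ v₃ β γ) :
    -- size of `K`
    0 ≤ K ∧ (v₁ ≠ 0 → 0 < K) ∧ K ≤ FreeDeconv.boundK v₁ v₃ (2 * max (√γ) β) ∧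
    -- `T_z` is a well-defined self-map of the disc `D(z, Im z / 5)`
    (∀ z ∈ FreeDeconv.upperPlane K, ∀ w ∈ Metric.ball z (z.im / 5),
      0 < w.im ∧ FreeDeconv.hTilde μ₃ w ≠ 0 ∧
      (FreeDeconv.hTilde μ₃ w)⁻¹ * z⁻¹ ∈ FreeDeconv.slitPlanePos ∧
      FreeDeconv.iterT μ₁ μ₃ z w ∈ Metric.ball z (z.im / 5)) ∧
    -- the pair `ω = (ω₁, ω₃)` of subordination functions
    ∃! ω : (FreeDeconv.upperPlane K → ℂ) × (FreeDeconv.upperPlane K → ℂ),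
      (∀ z, ω.1 z ∈ FreeDeconv.slitPlanePos ∧ 0 < (ω.2 z).im) ∧
      -- `ω₃(z)` is the only fixed point of `T_z` in the disc, and the iterates converge to it
      (∀ z : FreeDeconv.upperPlane K,
        (∀ w ∈ Metric.ball (z : ℂ) ((z : ℂ).im / 5),
          FreeDeconv.iterT μ₁ μ₃ z w = w ↔ w = ω.2 z) ∧
        ω.2 z ∈ Metric.ball (z : ℂ) ((z : ℂ).im / 5) ∧
        ∀ w ∈ Metric.ball (z : ℂ) ((z : ℂ).im / 5),
          Tendsto (fun n : ℕ => (FreeDeconv.iterT μ₁ μ₃ z)^[n] w) atTop (𝓝 (ω.2 z))) ∧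
      (∀ z : FreeDeconv.upperPlane K,
        ω.1 z = 1 / ((z : ℂ) * FreeDeconv.hTilde μ₃ (ω.2 z))) ∧
      -- recovery of `μ₂`
      (∀ μ₂ : Measure ℝ, IsProbabilityMeasure μ₂ → MemLp (id : ℝ → ℝ) 2 μ₂ →
        ∫ t, t ∂μ₂ ≠ 0 → FreeDeconv.IsFreeMulConv μ₁ μ₂ μ₃ →
        ∀ z : FreeDeconv.upperPlane K,
          FreeDeconv.recipF μ₂ z =
            FreeDeconv.recipF μ₃ (ω.2 z) * (z : ℂ) * (ω.2 z)⁻¹) := by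
  have hv₁0 : 0 ≤ v₁ := hv₁ ▸ variance_nonneg id μ₁
  have hv₃0 : 0 ≤ v₃ := hv₃ ▸ variance_nonneg id μ₃
  have hmom₁' : MemLp (id : ℝ → ℝ) 2 μ₁ := hmom₁.mono_exponent (by norm_num)
  have hβR : FreeDeconv.jacobiBeta μ₁ 1 ≤ max (2 * √γ) β := hβ ▸ le_max_right _ _
  have hγR : 2 * √(FreeDeconv.jacobiGamma μ₁ 1) ≤ max (2 * √γ) β := hγ ▸ le_max_left _ _
  have hR0 : 0 ≤ max (2 * √γ) β := le_max_of_le_left (by positivity)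
  replace hK : K = FreeDeconv.boundK v₁ v₃ (max (2 * √γ) β) := hK
  have hK0 : 0 ≤ K := hK ▸ FreeDeconv.boundK_nonneg hv₁0
  have him : ∀ z ∈ FreeDeconv.upperPlane K, 0 < z.im := fun z hz => hK0.trans_lt hz
  have hKz : ∀ z ∈ FreeDeconv.upperPlane K,
      FreeDeconv.boundK (variance id μ₁) (variance id μ₃) (max (2 * √γ) β) < z.im :=
    fun z hz => by rw [← hv₁, ← hv₃, ← hK]; exact hz
  refine ⟨hK0, fun h => hK ▸ FreeDeconv.boundK_pos (lt_of_le_of_ne hv₁0 h.symm), ?_, ?_, ?_⟩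
  · rw [hK]
    refine FreeDeconv.boundK_mono hv₃0 hR0 (max_le ?_ ?_)
    · have := le_max_left (√γ) β
      linarith
    · have h1 := le_max_right (√γ) β
      have h2 : 0 ≤ max (√γ) β := le_max_of_le_left (Real.sqrt_nonneg γ)
      linarith
  · intro z hz w hw
    refine ⟨by linarith [FreeDeconv.four_fifths_im_lt hw, him z hz],
      FreeDeconv.hTilde_ne_zero_of_mem_ball hmom₃ hmean₃ (him z hz) hw,
      FreeDeconv.subordination_mem_slitPlanePos hmom₃ hmean₃ (him z hz) hw,
      FreeDeconv.mapsTo_iterT hsupp hmom₁ hmom₃ hmean₁ hmean₃ hβR hγR (hKz z hz) hw⟩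
  · have hex := fun z (hz : z ∈ FreeDeconv.upperPlane K) => FreeDeconv.exists_fixedPoint_iterT
      hsupp hmom₁ hmom₃ hmean₁ hmean₃ hβR hγR (hKz z hz)
    -- Extended by an arbitrary value off the half-plane, so that `ω₃` is a function on `ℂ` whose
    -- differentiability can be discussed.
    have hex' : ∀ z : ℂ, ∃ x : ℂ, z ∈ FreeDeconv.upperPlane K →
        x ∈ Metric.ball z (z.im / 5) ∧ FreeDeconv.iterT μ₁ μ₃ z x = x ∧
        ∀ a ∈ Metric.ball z (z.im / 5), ∀ n : ℕ,
          ‖(FreeDeconv.iterT μ₁ μ₃ z)^[n] a - x‖ ≤ z.im / 5 * (2 * FreeDeconv.contractionConst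
            (FreeDeconv.selfMapRatio (variance id μ₁) (variance id μ₃) z.im) ^ n) := fun z => by
      by_cases hz : z ∈ FreeDeconv.upperPlane K
      · obtain ⟨x, h⟩ := hex z hz
        exact ⟨x, fun _ => h⟩
      · exact ⟨0, fun h => absurd h hz⟩
    choose ω₃ hω₃ using hex'
    have hball := fun z hz => (hω₃ z hz).1
    have hfix := fun z hz => (hω₃ z hz).2.1
    have hrate := fun z hz => (hω₃ z hz).2.2
    have hlim : ∀ z ∈ FreeDeconv.upperPlane K, ∀ w ∈ Metric.ball z (z.im / 5),
        Tendsto (fun n : ℕ => (FreeDeconv.iterT μ₁ μ₃ z)^[n] w) atTop (𝓝 (ω₃ z)) := by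
      intro z hz w hw
      rw [tendsto_iff_norm_sub_tendsto_zero]
      refine squeeze_zero (fun n => norm_nonneg _) (hrate z hz w hw) ?_
      have := ((tendsto_pow_atTop_nhds_zero_of_lt_one (FreeDeconv.contractionConst_nonneg _)
        (FreeDeconv.contractionConst_lt_one
          (FreeDeconv.selfMapRatio_nonneg (variance_nonneg id μ₁) (variance_nonneg id μ₃)
            (him z hz))
          (FreeDeconv.selfMapRatio_lt_one (variance_nonneg id μ₁) (variance_nonneg id μ₃)
            (hKz z hz)))).const_mul 2).const_mul (z.im / 5)
      simpa using this
    have huniq : ∀ z ∈ FreeDeconv.upperPlane K, ∀ w ∈ Metric.ball z (z.im / 5),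
        FreeDeconv.iterT μ₁ μ₃ z w = w → w = ω₃ z := by
      intro z hz w hw h
      refine tendsto_nhds_unique ?_ (hlim z hz w hw)
      simp only [Function.iterate_fixed h]
      exact tendsto_const_nhds
    have him₃ : ∀ z ∈ FreeDeconv.upperPlane K, 0 < (ω₃ z).im := fun z hz => by
      linarith [FreeDeconv.four_fifths_im_lt (hball z hz), him z hz]
    have hd := FreeDeconv.differentiableOn_fixedPoint hsupp hmom₁ hmom₃ hmean₁ hmean₃ hβR hγR
      (by rw [← hv₁, ← hv₃, ← hK]) hrate
    refine ⟨(fun z => 1 / ((z : ℂ) * FreeDeconv.hTilde μ₃ (ω₃ z)), fun z => ω₃ z),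
      ⟨fun z => ⟨?_, him₃ z z.2⟩, fun z => ⟨fun w hw => ⟨huniq z z.2 w hw, ?_⟩, hball z z.2,
        hlim z z.2⟩, fun z => rfl, ?_⟩, ?_⟩
    · have := FreeDeconv.subordination_mem_slitPlanePos hmom₃ hmean₃ (him z z.2) (hball z z.2)
      rwa [← mul_inv_rev, ← one_div] at this
    · rintro rfl
      exact hfix z z.2
    · intro μ₂ hμ₂ hmom₂ _ hconv z
      have key := FreeDeconv.recipF_mul_fixedPoint hmom₁' hmom₂ hmom₃ hmean₁ hmean₃ hconv hK0 hd
        hball huniq z z.2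
      rw [← key, mul_inv_cancel_right₀ (FreeDeconv.ne_zero_of_im_pos (him₃ z z.2))]
    -- The fixed point condition already determines `ω₃`, and then the formula determines `ω₁`; the
    -- recovery clause plays no part in uniqueness.
    · rintro ⟨ω₁', ω₃'⟩ ⟨-, h1, h2, -⟩
      have h3 : ω₃' = fun z : FreeDeconv.upperPlane K => ω₃ z := by
        funext z
        exact (((h1 z).1 (ω₃ z) (hball z z.2)).mp (hfix z z.2)).symm
      subst h3
      refine Prod.ext (funext fun z => h2 z) rfl
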